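/- A classical linkage $\mathcal L$ in $\mathbb R^2$ consists of a finite simple graph with vertex set $V$, a length $\ell(e)>0$ for each edge $e$, a set of fixed vertices and a prescribed position in $\mathbb R^2$ for each fixed vertex. Its configuration space $\mathcal C(\mathcal L)\subset(\mathbb R^2)^V$ is the set of maps $\varphi:V\to\mathbb R^2$ which send each fixed vertex to its prescribed position and satisfy $|\varphi(v)-\varphi(w)|=\ell(vw)$ for every edge $vw$; $\mathcal L$ is connected if its graph is (in particular $V\neq\emptyset$). Let $\mathrm{Euc}(2)$ be the group of maps $z\mapsto Qz+z_0$ of $\mathbb R^2$ with $Q\in O(2)$, $z_0\in\mathbb R^2$, let $\mathrm{Euc}(2)^+$ be the subgroup with $Q\in SO(2)$, regarded as the algebraic set of pairs $(Q,z_0)$ in $\mathbb R^{2\times2}\times\mathbb R^2$, and let both act diagonally on $(\mathbb R^2)^k$. An algebraic set is the set of common zeros of a collection of real polynomials. A bijection $f$ between subsets of finite-dimensional real vector spaces is an isomorphism if $f$ and $f^{-1}$ are restrictions of entire rational maps (coordinates are quotients of polynomials with nowhere vanishing denominator), and an analytic isomorphism if $f$ and $f^{-1}$ are restrictions of real-analytic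 maps defined on neighbourhoods of the respective sets. (1) Suppose $Z\subset(\mathbb R^2)^k$ is an algebraic set invariant under $\mathrm{Euc}(2)$, and suppose there is a compact algebraic subset $Z'\subset Z$ such that the map $Z'\times\mathrm{Euc}(2)^+\to Z$, $(z,g)\mapsto gz$, is an isomorphism. Then there are a connected classical linkage $\mathcal L$ in $\mathbb R^2$ with no fixed vertices and a nonempty finite set $F\subset\mathbb R$ such that $\mathcal C(\mathcal L)$ is analytically isomorphic to $Z\times F$. Moreover $\mathcal L$ and $F$ can be chosen such that, for some $m\ge0$ and some enumeration of the vertices of $\mathcal L$ which identifies $(\mathbb R^2)^V$ with $(\mathbb R^2)^k\times(\mathbb R^2)^m$, there is an analytic map $\alpha: Z\times F\to(\mathbb R^2)^m$ with $$\mathcal C(\mathcal L)=\{(x,\alpha(x,f))\mid x\in Z,\ f\in F\},$$ and $(x,f)\mapsto(x,\alpha(x,f))$ is an analytic isomorphism from $Z\times F$ to $\mathcal C(\mathcal L)$. (2) Conversely, if $\mathcal L$ is a connected classical linkage in $\mathbb R^2$ with no fixed vertices and at least two vertices, then there is a compact algebraic subset $Z'\subset\mathcal C(\mathcal L)$ such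 that $(z,g)\mapsto gz$ is an isomorphism from $Z'\times\mathrm{Euc}(2)^+$ to $\mathcal C(\mathcal L)$. -/

import Mathlib

noncomputable section

namespace LinkageSpaces

/-- Euclidean space `ℝⁿ`. -/
abbrev R (n : ℕ) : Type := EuclideanSpace ℝ (Fin n)

/-! ### Polynomial and entire rational maps, algebraic sets, isomorphisms

The following notions are used for finite dimensional real vector spaces only. -/

/-- A real polynomial function on a finite dimensional real vector space `E`: an element of the
algebra of functions generated by the real constants and the linear functionals (equivalently, by
the coordinate functions with respect to any basis). -/
def IsPolynomial {E : Type*} [AddCommGroup E] [Module ℝ E] (p : E → ℝ) : Prop :=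
  p ∈ Algebra.adjoin ℝ (Set.range fun l : Module.Dual ℝ E => (l : E → ℝ))

/-- A real algebraic set: the set of common zeros of a collection of real polynomials. -/
def IsAlgebraicSet {E : Type*} [AddCommGroup E] [Module ℝ E] (X : Set E) : Prop :=
  ∃ S : Set (E → ℝ), (∀ p ∈ S, IsPolynomial p) ∧ X = {x | ∀ p ∈ S, p x = 0}

/-- An entire rational function: a quotient of polynomials whose denominator vanishes nowhere. -/
def IsEntireRational {E : Type*} [AddCommGroup E] [Module ℝ E] (f : E → ℝ) : Prop :=
  ∃ p q : E → ℝ, IsPolynomial p ∧ IsPolynomial q ∧ (∀ x, q x ≠ 0) ∧ ∀ x, f x = p x / q x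

/-- A vector valued map is entire rational if all its coordinates (equivalently, all its
compositions with linear functionals) are. -/
def IsEntireRationalMap {E F : Type*} [AddCommGroup E] [Module ℝ E] [AddCommGroup F] [Module ℝ F]
    (f : E → F) : Prop :=
  ∀ l : Module.Dual ℝ F, IsEntireRational fun x => l (f x)

/-- `f` restricts to an isomorphism from `X` to `Y`: a bijection such that the bijection and its
inverse are restrictions of entire rational maps. (Entire rational maps are continuous, so that
the bijection is a homeomorphism.) -/
def IsIsomorphism {E F : Type*} [AddCommGroup E] [Module ℝ E] [AddCommGroup F] [Module ℝ F]
    (X : Set E) (Y : Set F) (f : E → F) : Prop :=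
  Set.BijOn f X Y ∧
    (∃ f' : E → F, IsEntireRationalMap f' ∧ Set.EqOn f' f X) ∧
    ∃ g : F → E, IsEntireRationalMap g ∧ Set.InvOn g f X Y

/-! ### Analytic maps and analytic isomorphisms of subsets of normed spaces -/

/-- On the subset `X`, `f` is the restriction of a map which is analytic (locally given by
convergent power series) at all points of `X`, and hence on an open neighbourhood of `X`. -/
def IsAnalyticOnSubset {E F : Type*} [NormedAddCommGroup E] [NormedSpace ℝ E]
    [NormedAddCommGroup F] [NormedSpace ℝ F] (X : Set E) (f : E → F) : Prop :=
  ∃ f' : E → F, AnalyticOnNhd ℝ f' X ∧ Set.EqOn f' f X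

/-- `f` restricts to an analytic isomorphism from `X` to `Y`: a bijection such that the bijection
and its inverse are restrictions of analytic maps. -/
def IsAnalyticIsomorphism {E F : Type*} [NormedAddCommGroup E] [NormedSpace ℝ E]
    [NormedAddCommGroup F] [NormedSpace ℝ F] (X : Set E) (Y : Set F) (f : E → F) : Prop :=
  Set.BijOn f X Y ∧ IsAnalyticOnSubset X f ∧
    ∃ g : F → E, AnalyticOnNhd ℝ g Y ∧ Set.InvOn g f X Y

/-- `X` and `Y` are analytically isomorphic. -/
def AnalyticallyIsomorphic {E F : Type*} [NormedAddCommGroup E] [NormedSpace ℝ E]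
    [NormedAddCommGroup F] [NormedSpace ℝ F] (X : Set E) (Y : Set F) : Prop :=
  ∃ f : E → F, IsAnalyticIsomorphism X Y f

/-! ### Euclidean motions -/

/-- The real vector space of pairs `(Q, t)` of an `n × n` matrix and a vector in `ℝⁿ`. -/
abbrev AffineData (n : ℕ) : Type := Matrix (Fin n) (Fin n) ℝ × R n

/-- The Euclidean group `Euc(n)` of the motions `z ↦ Q z + t` with `Q ∈ O(n)`, `t ∈ ℝⁿ`, as a
subset of the vector space of pairs `(Q, t)`. -/
def Euc (n : ℕ) : Set (AffineData n) :=
  {g | g.1 ∈ Matrix.orthogonalGroup (Fin n) ℝ}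

/-- The group `Euc(n)⁺` of orientation preserving Euclidean motions, those with `Q ∈ SO(n)`. -/
def EucPlus (n : ℕ) : Set (AffineData n) :=
  {g | g.1 ∈ Matrix.specialOrthogonalGroup (Fin n) ℝ}

/-- The diagonal action of `g = (Q, t)` on configurations of points of `ℝⁿ`: each point `z` is
sent to `Q z + t`. -/
def act {n : ℕ} {V : Type*} (g : AffineData n) (z : V → R n) : V → R n :=
  fun v => WithLp.toLp 2 (g.1.mulVec (z v).ofLp) + g.2

/-- `Z` is invariant under the diagonal action of `Euc(n)`. -/
def IsEucInvariant {n : ℕ} {V : Type*} (Z : Set (V → R n)) : Prop :=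
  ∀ g ∈ Euc n, ∀ z ∈ Z, act g z ∈ Z

/-! ### Linkages -/

/-- A classical linkage in `ℝⁿ` with vertex set `V` (a finite type, where it is used): a one
dimensional simplicial complex on `V` (a simple graph, isolated vertices being allowed), a positive
length for every edge, a set of fixed vertices, and the points where these are fixed. -/
structure ClassicalLinkage (n : ℕ) (V : Type*) where
  graph : SimpleGraph V
  len : graph.edgeSet → ℝ
  len_pos : ∀ e, 0 < len e
  fixed : Set V
  pos : fixed → R n

/-- The configuration space of a classical linkage. -/
def ClassicalLinkage.configSpace {n : ℕ} {V : Type*} (L : ClassicalLinkage n V) :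
    Set (V → R n) :=
  {φ | (∀ v : L.fixed, φ v = L.pos v) ∧
    ∀ (v w : V) (h : L.graph.Adj v w), ‖φ v - φ w‖ = L.len ⟨s(v, w), h⟩}

end LinkageSpaces

end

noncomputable section

namespace LinkageSpaces

open Complex

/-! ### Framed linkages in the complex plane -/

/-! For (2), choose an edge. Requiring its ends to lie at `0` and at its length on the real axis
cuts an algebraic slice out of the configuration space. The slice is bounded because the graph is
connected. The direction of the edge and the position of its first end recover the motion
polynomially, because the edge has constant length (`exists_slice`).

For (1), the compact slice `Z'` is the zero set of one nonnegative polynomial `p`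
(`IsAlgebraicSet.exists_nonneg`), and Kempe's method builds a linkage that evaluates `p`. The plane
is `ℂ`, and a rigid frame, provisionally held at `0, 1, i`, replaces fixed vertices. In a `Stage`,
the configurations form a finite disjoint union of graphs of analytic maps over the admissible
inputs. Vertices are attached so that this persists. Unwanted degenerate branches keep a positive
distance from the good ones, by compactness, and are made impossible by an additional two-bar elbow.
The one real device is a Peaucellier inversor with moving centre, `P + c / conj (P - Q)`
(`Stage.exists_negInv`). The rest is algebra: two inversions give a homothety, homotheties give sums
and real multiples, reciprocals give squares, and from these come products and conjugates
(`Constructible.of_isPolynomial`). One more bar imposes `p = 0` (`Stage.exists_zeroSet`). Elbows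
from the frame to the inputs make the linkage connected and confine the inputs to the compact region
where the construction is valid (`Stage.exists_anchor`).

When the frame is released, each configuration is a motion, possibly reversing orientation, of a
framed one. The splitting of `Z` reads the motion off from the inputs, and invariance under
reflection covers the mirror images. So over `Z` there are twice as many branches, still analytic
and disjoint (`Stage.unframed_spec`). Numbering them gives `F`
(`exists_analyticIsomorphism_of_sections`). -/

/-- The reference positions of the three frame vertices. -/
def framePos : Fin 3 → ℂ := ![0, 1, I]

/-- A planar linkage with marked input vertices and a rigid frame, whose configurations with frame
in the reference position and with inputs in `W` form finitely many analytic branches over `Z`.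
An entry `0` of `len` stands for the absence of an edge. -/
structure Stage (ι : Type) [Fintype ι] (T : Set ι) (W Z : Set (ι → ℂ)) where
  V : Type
  [fin : Fintype V]
  inp : ι → V
  inp_inj : Function.Injective inp
  fr : Fin 3 → V
  inp_ne_fr : ∀ i j, inp i ≠ fr j
  len : V → V → ℝ
  len_nonneg : ∀ v w, 0 ≤ len v w
  len_symm : ∀ v w, len v w = len w v
  len_self : ∀ v, len v v = 0
  len_fr : ∀ i j, len (fr i) (fr j) = ‖framePos i - framePos j‖
  F : Type
  [finF : Finite F]
  [neF : Nonempty F]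
  pt : F → (ι → ℂ) → V → ℂ
  pt_inp : ∀ f x i, pt f x (inp i) = x i
  analytic : ∀ f v, AnalyticOnNhd ℝ (fun x => pt f x v) Z
  sep : ∀ f f', ∀ x ∈ Z, pt f x = pt f' x → f = f'
  spec : ∀ φ : V → ℂ, φ ∘ inp ∈ W →
    (((∀ i, φ (fr i) = framePos i) ∧ ∀ v w, len v w ≠ 0 → ‖φ v - φ w‖ = len v w) ↔
      (φ ∘ inp ∈ Z ∧ ∃ f, φ = pt f (φ ∘ inp)))
  conn : ∀ P : V → Prop, (∀ v w, len v w ≠ 0 → P v → P w) → P (fr 0) → (∀ i ∈ T, P (inp i)) →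
    ∀ v, P v

attribute [instance] Stage.fin Stage.finF Stage.neF

namespace Stage

variable {ι : Type} [Fintype ι] {T T' : Set ι} {W W' Z Z' : Set (ι → ℂ)}

theorem pt_comp_inp (S : Stage ι T W Z) (f : S.F) (x : ι → ℂ) : S.pt f x ∘ S.inp = x :=
  funext fun i => S.pt_inp f x i

theorem pt_config (S : Stage ι T W Z) (hZ : Z ⊆ W) (f : S.F) {x : ι → ℂ} (hx : x ∈ Z) :
    (∀ i, S.pt f x (S.fr i) = framePos i) ∧
      ∀ v w, S.len v w ≠ 0 → ‖S.pt f x v - S.pt f x w‖ = S.len v w := by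
  have h := S.spec (S.pt f x)
  rw [S.pt_comp_inp] at h
  exact (h (hZ hx)).2 ⟨hx, f, rfl⟩

/-- The edge lengths after adding a vertex `none` at distances `r` from the old vertices. -/
def extendLen {V : Type} (len : V → V → ℝ) (r : V → ℝ) : Option V → Option V → ℝ
  | some v, some w => len v w
  | some v, none => r v
  | none, some w => r w
  | none, none => 0

/-- Adding a vertex whose possible positions are known. -/
def extend (S : Stage ι T W Z) (r : S.V → ℝ) (hr : ∀ v, 0 ≤ r v) (hr0 : ∃ v, r v ≠ 0)
    (hWW : ∀ φ : S.V → ℂ, ∀ z, φ ∘ S.inp ∈ W' → (∀ i, φ (S.fr i) = framePos i) →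
      (∀ v, r v ≠ 0 → ‖z - φ v‖ = r v) → φ ∘ S.inp ∈ W)
    (hZW : Z ⊆ W) (hZ : Z' ⊆ Z) (F' : Type) [Finite F'] [Nonempty F'] (π : F' → S.F)
    (β : F' → (ι → ℂ) → ℂ) (hβ : ∀ f, AnalyticOnNhd ℝ (β f) Z')
    (hsep : ∀ f f', ∀ x ∈ Z', π f = π f' → β f x = β f' x → f = f')
    (hsol : ∀ x ∈ Z, x ∈ W' → ∀ f z, (∀ v, r v ≠ 0 → ‖z - S.pt f x v‖ = r v) ↔
      (x ∈ Z' ∧ ∃ f', π f' = f ∧ z = β f' x))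
    (hT : ∀ i ∈ T, i ∈ T' ∨ (r (S.fr 0) ≠ 0 ∧ r (S.inp i) ≠ 0)) : Stage ι T' W' Z' where
  V := Option S.V
  inp i := some (S.inp i)
  inp_inj i j h := S.inp_inj (Option.some_injective _ h)
  fr i := some (S.fr i)
  inp_ne_fr i j h := S.inp_ne_fr i j (Option.some_injective _ h)
  len := extendLen S.len r
  len_nonneg v w := by
    cases v <;> cases w <;> simp [extendLen, S.len_nonneg, hr]
  len_symm v w := by
    cases v <;> cases w <;> simp [extendLen]
    exact S.len_symm _ _
  len_self v := by
    cases v <;> simp [extendLen, S.len_self]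
  len_fr i j := S.len_fr i j
  F := F'
  pt f x v := v.elim (β f x) (S.pt (π f) x)
  pt_inp f x i := S.pt_inp _ _ _
  analytic f v := by
    cases v with
    | none => exact hβ f
    | some v => exact (S.analytic (π f) v).mono hZ
  sep f f' x hx h := by
    refine hsep f f' x hx (S.sep _ _ x (hZ hx) ?_) (congrFun h none)
    exact funext fun v => congrFun h (some v)
  spec φ hφ := by
    have hold := S.spec (φ ∘ some)
    constructor
    · rintro ⟨h1, h2⟩
      have h3 : ∀ v, r v ≠ 0 → ‖φ none - φ (some v)‖ = r v := fun v hv => h2 none (some v) hv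
      -- The new bars may themselves confine the inputs, so `W'` can be larger than `W`. The old
      -- specification applies only after this step.
      have hW : (φ ∘ some) ∘ S.inp ∈ W := hWW (φ ∘ some) (φ none) hφ h1 h3
      obtain ⟨hz, f, hf⟩ := (hold hW).1 ⟨h1, fun v w h => h2 (some v) (some w) h⟩
      have h4 := (hsol _ hz hφ f (φ none)).1 (by
        intro v hv
        rw [← hf]
        exact h3 v hv)
      obtain ⟨hz', f', hf', hn⟩ := h4
      refine ⟨hz', f', funext fun v => ?_⟩
      cases v with
      | none => exact hn
      | some v =>
        have := congrFun hf v
        rw [← hf'] at this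
        exact this
    · rintro ⟨hz', f', hf'⟩
      have hz := hZ hz'
      have hs : φ ∘ some = S.pt (π f') ((φ ∘ some) ∘ S.inp) :=
        funext fun v => congrFun hf' (some v)
      obtain ⟨h1, h2⟩ := (hold (hZW hz)).2 ⟨hz, _, hs⟩
      have h3 := (hsol _ hz hφ (π f') (φ none)).2 ⟨hz', f', rfl, congrFun hf' none⟩
      have h3' : ∀ v, r v ≠ 0 → ‖φ none - φ (some v)‖ = r v := by
        intro v hv
        rw [← h3 v hv]
        exact congrArg (fun t => ‖φ none - t‖) (congrFun hs v)
      refine ⟨h1, fun v w h => ?_⟩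
      cases v with
      | none =>
        cases w with
        | none => exact absurd rfl h
        | some w => exact h3' w h
      | some v =>
        cases w with
        | none => rw [norm_sub_rev]; exact h3' v h
        | some w => exact h2 v w h
  conn P hP h0 hi v := by
    have key : ∀ v, P (some v) := by
      refine S.conn (fun v => P (some v)) (fun v w h => hP (some v) (some w) h) h0 ?_
      intro i hiT
      -- An input dropped from `T` is reached from the frame through the new vertex.
      rcases hT i hiT with h | ⟨ha, hb⟩
      · exact hi i h
      · exact hP none (some (S.inp i)) hb (hP (some (S.fr 0)) none ha h0)
    cases v with
    | some v => exact key v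
    | none =>
      obtain ⟨v, hv⟩ := hr0
      exact hP (some v) none hv (key v)

/-- The linkage consisting of the frame and the inputs. -/
def initial (ι : Type) [Fintype ι] (W : Set (ι → ℂ)) : Stage ι Set.univ W W where
  V := ι ⊕ Fin 3
  inp := Sum.inl
  inp_inj := Sum.inl_injective
  fr := Sum.inr
  inp_ne_fr i j h := nomatch h
  len := Sum.elim (fun _ _ => 0) fun i => Sum.elim (fun _ => 0) fun j => ‖framePos i - framePos j‖
  len_nonneg v w := by
    rcases v with v | v <;> rcases w with w | w <;> simp
  len_symm v w := by
    rcases v with v | v <;> rcases w with w | w <;> simp [norm_sub_rev]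
  len_self v := by
    rcases v with v | v <;> simp
  len_fr i j := rfl
  F := Unit
  pt _ x := Sum.elim x framePos
  pt_inp _ _ _ := rfl
  analytic f v := by
    rcases v with v | v
    · exact fun x _ => (ContinuousLinearMap.proj (R := ℝ) (φ := fun _ : ι => ℂ) v).analyticAt x
    · exact analyticOnNhd_const
  sep _ _ _ _ _ := rfl
  spec φ hφ := by
    constructor
    · rintro ⟨h1, -⟩
      refine ⟨hφ, (), funext fun v => ?_⟩
      rcases v with v | v
      · rfl
      · exact h1 v
    · rintro ⟨-, -, h⟩
      have h1 : ∀ i, φ (Sum.inr i) = framePos i := fun i => congrFun h (Sum.inr i)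
      refine ⟨h1, fun v w h => ?_⟩
      rcases v with v | v
      · exact absurd rfl h
      · rcases w with w | w
        · exact absurd rfl h
        · simp [h1]
  conn P hP h0 hi v := by
    rcases v with v | v
    · exact hi v trivial
    · by_cases hv : v = 0
      · rw [hv]; exact h0
      · refine hP (Sum.inr 0) (Sum.inr v) ?_ h0
        fin_cases v
        · exact absurd rfl hv
        · simp [framePos]
        · simp [framePos]

/-- A vertex of the linkage has position `h x` in all branches. -/
def Computes (S : Stage ι T W Z) (h : (ι → ℂ) → ℂ) : Prop :=
  ∃ v : S.V, ∀ f, ∀ x ∈ W, S.pt f x v = h x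

end Stage

/-! ### Intersections of two circles -/

/-- The discriminant of the intersection of circles of radii `r` and `s` whose centres have
squared distance `t`. -/
def circleDisc (r s t : ℝ) : ℝ := t * r ^ 2 - ((t + r ^ 2 - s ^ 2) / 2) ^ 2

/-- The intersection points of the circles with centres `P`, `Q` and radii `r`, `s`. -/
def apex (r s : ℝ) (b : Bool) (P Q : ℂ) : ℂ :=
  P + (Q - P) / (normSq (Q - P) : ℂ) *
    ((((normSq (Q - P) + r ^ 2 - s ^ 2) / 2 : ℝ) : ℂ) +
      (bif b then 1 else -1) * I * ((√(circleDisc r s (normSq (Q - P))) : ℝ) : ℂ))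

/-- Heron's factorization: each factor is positive by one of the strict triangle inequalities. -/
theorem circleDisc_pos {r s d : ℝ} (hd : 0 < d) (h1 : |r - s| < d) (h2 : d < r + s) :
    0 < circleDisc r s (d ^ 2) := by
  have : circleDisc r s (d ^ 2) = ((r + s) ^ 2 - d ^ 2) * (d ^ 2 - (r - s) ^ 2) / 4 := by
    unfold circleDisc; ring
  rw [this]
  have h3 : (r - s) ^ 2 < d ^ 2 := by
    rw [← sq_abs (r - s)]; exact pow_lt_pow_left₀ h1 (abs_nonneg _) two_ne_zero
  have h4 : d ^ 2 < (r + s) ^ 2 := pow_lt_pow_left₀ h2 hd.le two_ne_zero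
  have := mul_pos (sub_pos.2 h4) (sub_pos.2 h3)
  positivity

/-- In the coordinate `w` given by `z = P + (Q - P) w / t`, with `t = |Q - P|²`, the circles become
`|w|² = t r²` and `|w - t|² = t s²`. Their difference fixes the real part of `w`, and the
discriminant is the square of its imaginary part. -/
theorem mem_circles_iff {r s : ℝ} (hr : 0 < r) (hs : 0 < s) {P Q : ℂ}
    (hPQ : P ≠ Q) (hD : 0 < circleDisc r s (normSq (Q - P))) (z : ℂ) :
    (‖z - P‖ = r ∧ ‖z - Q‖ = s) ↔ z = apex r s true P Q ∨ z = apex r s false P Q := by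
  have hD0 : Q - P ≠ 0 := sub_ne_zero.2 hPQ.symm
  obtain ⟨w, hw⟩ : ∃ w, z = P + (Q - P) / (normSq (Q - P) : ℂ) * w :=
    ⟨(z - P) * (normSq (Q - P) : ℂ) / (Q - P), by
      have : (normSq (Q - P) : ℂ) ≠ 0 := by exact_mod_cast (normSq_pos.2 hD0).ne'
      field_simp; ring⟩
  set t := normSq (Q - P) with ht
  have htp : 0 < t := normSq_pos.2 hD0
  have htc : (t : ℂ) ≠ 0 := by exact_mod_cast htp.ne'
  have e1 : ‖z - P‖ = r ↔ w.re ^ 2 + w.im ^ 2 = t * r ^ 2 := by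
    rw [← sq_eq_sq₀ (norm_nonneg _) hr.le, ← normSq_eq_norm_sq, hw, add_sub_cancel_left, map_mul,
      map_div₀, ← ht, normSq_ofReal, normSq_apply w]
    rw [div_mul_eq_mul_div, div_eq_iff (by positivity)]
    constructor
    · intro h; apply mul_left_cancel₀ htp.ne'; linear_combination h
    · intro h; linear_combination t * h
  have e2 : ‖z - Q‖ = s ↔ (w.re - t) ^ 2 + w.im ^ 2 = t * s ^ 2 := by
    have : z - Q = (Q - P) / (t : ℂ) * (w - t) := by
      rw [hw]; field_simp; ring
    rw [← sq_eq_sq₀ (norm_nonneg _) hs.le, ← normSq_eq_norm_sq, this, map_mul,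
      map_div₀, ← ht, normSq_ofReal, normSq_apply (w - t)]
    rw [div_mul_eq_mul_div, div_eq_iff (by positivity)]
    simp only [sub_re, sub_im, ofReal_re, ofReal_im, sub_zero]
    constructor
    · intro h; apply mul_left_cancel₀ htp.ne'; linear_combination h
    · intro h; linear_combination t * h
  have e3 : ∀ u : ℂ, z = P + (Q - P) / (t : ℂ) * u ↔ w = u := by
    intro u
    rw [hw]
    have : (Q - P) / (t : ℂ) ≠ 0 := div_ne_zero hD0 htc
    constructor
    · intro h; exact mul_left_cancel₀ this (add_left_cancel h)
    · rintro rfl; rfl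
  rw [e1, e2, apex, apex, ← ht, e3, e3]
  have hsq : (√(circleDisc r s t)) ^ 2 = circleDisc r s t := Real.sq_sqrt hD.le
  have e4 : ∀ (ε : ℂ) (y : ℝ), ε = 1 ∨ ε = -1 → (w = ((((t + r ^ 2 - s ^ 2) / 2 : ℝ) : ℂ) +
      ε * I * (y : ℂ)) ↔ w.re = (t + r ^ 2 - s ^ 2) / 2 ∧ w.im = ε.re * y) := by
    intro ε y hε
    generalize (t + r ^ 2 - s ^ 2) / 2 = A
    rcases hε with rfl | rfl <;> simp [Complex.ext_iff]
  rw [cond_true, cond_false, e4 _ _ (Or.inl rfl), e4 _ _ (Or.inr rfl), one_re, neg_re, one_re,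
    one_mul, neg_one_mul]
  constructor
  · rintro ⟨h1, h2⟩
    have hre : w.re = (t + r ^ 2 - s ^ 2) / 2 := by
      apply mul_left_cancel₀ htp.ne'; linear_combination (h1 - h2) / 2
    have him : w.im ^ 2 = (√(circleDisc r s t)) ^ 2 := by
      rw [hsq, circleDisc, ← hre]; linear_combination h1
    rcases sq_eq_sq_iff_eq_or_eq_neg.1 him with h | h
    · left; exact ⟨hre, h⟩
    · right; exact ⟨hre, h⟩
  · have hfin : ∀ y : ℝ, y ^ 2 = circleDisc r s t → w.re = (t + r ^ 2 - s ^ 2) / 2 → w.im = y →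
        w.re ^ 2 + w.im ^ 2 = t * r ^ 2 ∧ (w.re - t) ^ 2 + w.im ^ 2 = t * s ^ 2 := by
      intro y hy h1 h2
      rw [h2, hy, h1, circleDisc]
      constructor <;> ring
    rintro (⟨h1, h2⟩ | ⟨h1, h2⟩)
    · exact hfin _ hsq h1 h2
    · exact hfin _ (by rw [neg_sq, hsq]) h1 h2

theorem normSq_apex_sub {r s : ℝ} {P Q : ℂ}
    (hPQ : P ≠ Q) (hD : 0 < circleDisc r s (normSq (Q - P))) :
    ‖apex r s true P Q - apex r s false P Q‖ ^ 2 =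
      4 * circleDisc r s (normSq (Q - P)) / normSq (Q - P) := by
  have hD0 : Q - P ≠ 0 := sub_ne_zero.2 hPQ.symm
  have htp : 0 < normSq (Q - P) := normSq_pos.2 hD0
  have : apex r s true P Q - apex r s false P Q = (Q - P) / (normSq (Q - P) : ℂ) *
      (2 * I * ((√(circleDisc r s (normSq (Q - P))) : ℝ) : ℂ)) := by
    simp [apex]; ring
  rw [this, ← normSq_eq_norm_sq, map_mul, map_div₀, map_mul, map_mul, normSq_ofReal, normSq_ofReal,
    Real.mul_self_sqrt hD.le]
  simp
  field_simp
  norm_num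

theorem apex_true_ne_false {r s : ℝ} {P Q : ℂ}
    (hPQ : P ≠ Q) (hD : 0 < circleDisc r s (normSq (Q - P))) :
    apex r s true P Q ≠ apex r s false P Q := by
  intro h
  have h1 := normSq_apex_sub hPQ hD
  have htp : 0 < normSq (Q - P) := normSq_pos.2 (sub_ne_zero.2 hPQ.symm)
  rw [h, sub_self] at h1
  have : 0 < 4 * circleDisc r s (normSq (Q - P)) / normSq (Q - P) := by positivity
  rw [← h1] at this
  simp at this

theorem analyticAt_sqrt {x : ℝ} (hx : x ≠ 0) : AnalyticAt ℝ Real.sqrt x :=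
  ContDiffAt.analyticAt (Real.contDiffAt_sqrt hx)

section Analytic

variable {E : Type*} [NormedAddCommGroup E] [NormedSpace ℝ E] {x : E}

theorem analyticAt_ofReal {g : E → ℝ} (hg : AnalyticAt ℝ g x) :
    AnalyticAt ℝ (fun y => (g y : ℂ)) x :=
  (ofRealCLM.analyticAt _).comp hg

theorem analyticAt_conj {g : E → ℂ} (hg : AnalyticAt ℝ g x) :
    AnalyticAt ℝ (fun y => (starRingEnd ℂ) (g y)) x :=
  ((conjCLE : ℂ →L[ℝ] ℂ).analyticAt _).comp hg

theorem analyticAt_re {g : E → ℂ} (hg : AnalyticAt ℝ g x) :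
    AnalyticAt ℝ (fun y => (g y).re) x :=
  (reCLM.analyticAt _).comp hg

theorem analyticAt_im {g : E → ℂ} (hg : AnalyticAt ℝ g x) :
    AnalyticAt ℝ (fun y => (g y).im) x :=
  (imCLM.analyticAt _).comp hg

theorem analyticAt_normSq {g : E → ℂ} (hg : AnalyticAt ℝ g x) :
    AnalyticAt ℝ (fun y => normSq (g y)) x := by
  simp only [normSq_apply]
  exact ((analyticAt_re hg).mul (analyticAt_re hg)).add ((analyticAt_im hg).mul (analyticAt_im hg))

theorem analyticAt_div {g h : E → ℂ} (hg : AnalyticAt ℝ g x) (hh : AnalyticAt ℝ h x)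
    (h0 : h x ≠ 0) : AnalyticAt ℝ (fun y => g y / h y) x :=
  hg.div hh h0

theorem analyticAt_apex {r s : ℝ} (b : Bool) {P Q : E → ℂ} (hP : AnalyticAt ℝ P x)
    (hQ : AnalyticAt ℝ Q x) (hPQ : P x ≠ Q x)
    (hD : 0 < circleDisc r s (normSq (Q x - P x))) :
    AnalyticAt ℝ (fun y => apex r s b (P y) (Q y)) x := by
  have hN := analyticAt_normSq (hQ.sub hP)
  have hN0 : ((normSq (Q x - P x) : ℝ) : ℂ) ≠ 0 := by
    exact_mod_cast (normSq_pos.2 (sub_ne_zero.2 hPQ.symm)).ne'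
  have hc : AnalyticAt ℝ (fun y => circleDisc r s (normSq (Q y - P y))) x := by
    unfold circleDisc
    exact (hN.mul analyticAt_const).sub
      ((((hN.add analyticAt_const).sub analyticAt_const).div_const).pow 2)
  have hs := AnalyticAt.comp (f := fun y => circleDisc r s (normSq (Q y - P y)))
    (analyticAt_sqrt hD.ne') hc
  unfold apex
  refine hP.add ((analyticAt_div (hQ.sub hP) (analyticAt_ofReal hN) hN0).mul
    ((analyticAt_ofReal ?_).add (analyticAt_const.mul (analyticAt_ofReal hs))))
  exact ((hN.add analyticAt_const).sub analyticAt_const).div_const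

end Analytic

/-! ### Gadgets -/

namespace Stage

variable {ι : Type} [Fintype ι] {T : Set ι} {W : Set (ι → ℂ)}

/-- The branch `f'` of `S'` restricts to the branch `f` of `S`. -/
def Lifts (S S' : Stage ι T W W) (emb : S.V → S'.V) (f : S.F) (f' : S'.F) : Prop :=
  ∀ x u, S'.pt f' x (emb u) = S.pt f x u

/-- The basic move with two bars: a good branch splits into the two positions `β`, and a bad branch
disappears because the bars cannot close. The second conclusion says that no good branch is lost, so
later steps can still exhibit a wanted branch. -/
theorem exists_addPair (S : Stage ι T W W) {v w : S.V} (hvw : v ≠ w) {r s : ℝ} (hr : 0 < r)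
    (hs : 0 < s) (good : S.F → Prop) (hne : ∃ f, good f) (β : Bool → S.F → (ι → ℂ) → ℂ)
    (hβ : ∀ b f, good f → AnalyticOnNhd ℝ (β b f) W)
    (hd : ∀ f, good f → ∀ x ∈ W, β true f x ≠ β false f x)
    (hgood : ∀ f, good f → ∀ x ∈ W, ∀ z,
      (‖z - S.pt f x v‖ = r ∧ ‖z - S.pt f x w‖ = s) ↔ z = β true f x ∨ z = β false f x)
    (hbad : ∀ f, ¬ good f → ∀ x ∈ W, ∀ z, ¬ (‖z - S.pt f x v‖ = r ∧ ‖z - S.pt f x w‖ = s)) :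
    ∃ (S' : Stage ι T W W) (emb : S.V → S'.V) (n : S'.V),
      (∀ f', ∃ f b, good f ∧ S.Lifts S' emb f f' ∧ ∀ x, S'.pt f' x n = β b f x) ∧
      (∀ f b, good f → ∃ f', S.Lifts S' emb f f' ∧ ∀ x, S'.pt f' x n = β b f x) := by
  classical
  obtain ⟨f₀, hf₀⟩ := hne
  have : Nonempty ({f // good f} × Bool) := ⟨(⟨f₀, hf₀⟩, true)⟩
  let S' : Stage ι T W W := S.extend (Z' := W) (W' := W) (T' := T)
    (fun u => if u = v then r else if u = w then s else 0)
    (fun u => by split_ifs <;> simp [hr.le, hs.le]) ⟨v, by simp [hr.ne']⟩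
    (fun _ _ h _ _ => h) subset_rfl subset_rfl ({f // good f} × Bool) (fun p => p.1)
    (fun p => β p.2 p.1) (fun p => hβ _ _ p.1.2)
    (by
      rintro ⟨⟨f, hf⟩, b⟩ ⟨⟨f', hf'⟩, b'⟩ x hx h h'
      obtain rfl : f = f' := h
      have := hd f hf x hx
      cases b <;> cases b' <;> first | rfl | exact absurd h' this | exact absurd h'.symm this)
    (by
      intro x hx _ f z
      have e : (∀ u, (if u = v then r else if u = w then s else 0) ≠ 0 →
          ‖z - S.pt f x u‖ = (if u = v then r else if u = w then s else 0)) ↔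
          (‖z - S.pt f x v‖ = r ∧ ‖z - S.pt f x w‖ = s) := by
        constructor
        · intro h
          have h1 := h v (by simp [hr.ne'])
          have h2 := h w (by simp [hvw.symm, hs.ne'])
          simp only [if_true, hvw.symm, if_false] at h1 h2
          exact ⟨h1, h2⟩
        · rintro ⟨h1, h2⟩ u hu
          split_ifs at hu ⊢ with hv hw
          · rw [hv, h1]
          · rw [hw, h2]
          · exact absurd rfl hu
      rw [e]
      by_cases hf : good f
      · rw [hgood f hf x hx]
        constructor
        · rintro (h | h)
          · exact ⟨hx, (⟨f, hf⟩, true), rfl, h⟩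
          · exact ⟨hx, (⟨f, hf⟩, false), rfl, h⟩
        · rintro ⟨-, ⟨⟨f', hf'⟩, b⟩, h, h'⟩
          obtain rfl : f' = f := h
          cases b
          · exact Or.inr h'
          · exact Or.inl h'
      · refine iff_of_false (hbad f hf x hx z) ?_
        rintro ⟨-, ⟨⟨f', hf'⟩, b⟩, h, h'⟩
        obtain rfl : f' = f := h
        exact hf hf')
    (fun i hi => Or.inl hi)
  refine ⟨S', some, none, ?_, ?_⟩
  · rintro ⟨⟨f, hf⟩, b⟩
    exact ⟨f, b, hf, fun x u => rfl, fun x => rfl⟩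
  · intro f b hf
    exact ⟨(⟨f, hf⟩, b), fun x u => rfl, fun x => rfl⟩

theorem disc_pos_of_dist {r s : ℝ} {P Q : ℂ} (h1 : |r - s| < ‖P - Q‖) (h2 : ‖P - Q‖ < r + s) :
    P ≠ Q ∧ 0 < circleDisc r s (normSq (Q - P)) := by
  have hd : 0 < ‖P - Q‖ := (abs_nonneg _).trans_lt h1
  refine ⟨fun h => by simp [h] at hd, ?_⟩
  rw [normSq_eq_norm_sq, norm_sub_rev]
  exact circleDisc_pos hd h1 h2

/-- Two bars close up in two distinct positions when the distance of their ends lies strictly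
between `|r - s|` and `r + s`. Below `|r - s|` the triangle inequality forbids closing. -/
theorem exists_apex (S : Stage ι T W W) (hW : W.Nonempty) {v w : S.V} {r s : ℝ} (hr : 0 < r)
    (hs : 0 < s) (good : S.F → Prop) (hne : ∃ f, good f)
    (hgood : ∀ f, good f → ∀ x ∈ W, |r - s| < ‖S.pt f x v - S.pt f x w‖ ∧
      ‖S.pt f x v - S.pt f x w‖ < r + s)
    (hbad : ∀ f, ¬ good f → ∀ x ∈ W, ‖S.pt f x v - S.pt f x w‖ < |r - s|) :
    ∃ (S' : Stage ι T W W) (emb : S.V → S'.V) (n : S'.V),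
      (∀ f', ∃ f b, good f ∧ S.Lifts S' emb f f' ∧
        ∀ x, S'.pt f' x n = apex r s b (S.pt f x v) (S.pt f x w)) ∧
      (∀ f b, good f → ∃ f', S.Lifts S' emb f f' ∧
        ∀ x, S'.pt f' x n = apex r s b (S.pt f x v) (S.pt f x w)) := by
  have key : ∀ f, good f → ∀ x ∈ W, S.pt f x v ≠ S.pt f x w ∧
      0 < circleDisc r s (normSq (S.pt f x w - S.pt f x v)) := fun f hf x hx =>
    disc_pos_of_dist (hgood f hf x hx).1 (hgood f hf x hx).2
  refine S.exists_addPair (v := v) (w := w) ?_ hr hs good hne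
    (fun b f x => apex r s b (S.pt f x v) (S.pt f x w)) ?_ ?_ ?_ ?_
  · rintro rfl
    obtain ⟨f, hf⟩ := hne
    obtain ⟨x, hx⟩ := hW
    exact (key f hf x hx).1 rfl
  · intro b f hf x hx
    exact analyticAt_apex b (S.analytic f v x hx) (S.analytic f w x hx) (key f hf x hx).1
      (key f hf x hx).2
  · intro f hf x hx
    exact apex_true_ne_false (key f hf x hx).1 (key f hf x hx).2
  · intro f hf x hx z
    exact mem_circles_iff hr hs (key f hf x hx).1 (key f hf x hx).2 z
  · rintro f hf x hx z ⟨h1, h2⟩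
    have h3 := abs_norm_sub_norm_le (z - S.pt f x v) (z - S.pt f x w)
    rw [h1, h2, sub_sub_sub_cancel_left, norm_sub_rev] at h3
    exact absurd (hbad f hf x hx) (not_lt.2 h3)

/-- Attaching an elbow to two vertices removes the branches where they are too close. -/
theorem exists_elbow (S : Stage ι T W W) (hW : W.Nonempty) (v w : S.V) {ρ₁ ρ₂ : ℝ}
    (h1 : 0 < ρ₁) (h2 : ρ₁ < ρ₂) (good : S.F → Prop) (hne : ∃ f, good f)
    (hgood : ∀ f, good f → ∀ x ∈ W, ρ₁ < ‖S.pt f x v - S.pt f x w‖ ∧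
      ‖S.pt f x v - S.pt f x w‖ < ρ₂)
    (hbad : ∀ f, ¬ good f → ∀ x ∈ W, ‖S.pt f x v - S.pt f x w‖ < ρ₁) :
    ∃ (S' : Stage ι T W W) (emb : S.V → S'.V), ∀ f', ∃ f, good f ∧ S.Lifts S' emb f f' := by
  -- These bar lengths have difference `ρ₁` and sum `ρ₂`, so the elbow reaches exactly the distances
  -- from `ρ₁` to `ρ₂`.
  have e1 : |(ρ₂ + ρ₁) / 2 - (ρ₂ - ρ₁) / 2| = ρ₁ := by
    rw [show (ρ₂ + ρ₁) / 2 - (ρ₂ - ρ₁) / 2 = ρ₁ by ring, abs_of_pos h1]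
  have e2 : (ρ₂ + ρ₁) / 2 + (ρ₂ - ρ₁) / 2 = ρ₂ := by ring
  obtain ⟨S', emb, n, h, -⟩ := S.exists_apex hW (v := v) (w := w) (r := (ρ₂ + ρ₁) / 2)
    (s := (ρ₂ - ρ₁) / 2) (by linarith) (by linarith) good hne (by rwa [e1, e2]) (by rwa [e1])
  refine ⟨S', emb, fun f' => ?_⟩
  obtain ⟨f, b, hf, hl, -⟩ := h f'
  exact ⟨f, hf, hl⟩

/-- The stage `S'` computes everything that `S` computes. -/
def Refines (S S' : Stage ι T W W) : Prop := ∀ h, S.Computes h → S'.Computes h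

theorem Refines.trans {S S' S'' : Stage ι T W W} (h : S.Refines S') (h' : S'.Refines S'') :
    S.Refines S'' := fun k hk => h' k (h k hk)

theorem computes_of_lifts {S S' : Stage ι T W W} {emb : S.V → S'.V}
    (h : ∀ f', ∃ f, S.Lifts S' emb f f') {v : S.V} {k : (ι → ℂ) → ℂ}
    (hv : ∀ f, ∀ x ∈ W, S.pt f x v = k x) : ∀ f', ∀ x ∈ W, S'.pt f' x (emb v) = k x := by
  intro f' x hx
  obtain ⟨f, hf⟩ := h f'
  rw [hf, hv f x hx]

theorem refines_of_lifts {S S' : Stage ι T W W} {emb : S.V → S'.V}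
    (h : ∀ f', ∃ f, S.Lifts S' emb f f') : S.Refines S' := by
  rintro k ⟨v, hv⟩
  exact ⟨emb v, computes_of_lifts h hv⟩

theorem Computes.continuousOn {S : Stage ι T W W} {k : (ι → ℂ) → ℂ} (h : S.Computes k) :
    ContinuousOn k W := by
  obtain ⟨v, hv⟩ := h
  obtain ⟨f⟩ := S.neF
  exact ((S.analytic f v).continuousOn).congr fun x hx => (hv f x hx).symm

/-- The frame is not collinear, so the differences of the squared distances are linear equations
that determine both coordinates. -/
theorem eq_of_frame_dist {z c : ℂ} (h : ∀ i, ‖z - framePos i‖ = ‖c - framePos i‖) : z = c := by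
  have h0 := congrArg (· ^ 2) (h 0)
  have h1 := congrArg (· ^ 2) (h 1)
  have h2 := congrArg (· ^ 2) (h 2)
  simp only [← normSq_eq_norm_sq, framePos, normSq_apply] at h0 h1 h2
  simp at h0 h1 h2
  apply Complex.ext <;> linarith

theorem framePos_injective : Function.Injective framePos := by
  intro i j h
  fin_cases i <;> fin_cases j <;> simp [framePos, Complex.ext_iff] at h ⊢

section Frame

variable {T' : Set ι} {W' Z' : Set (ι → ℂ)} (S : Stage ι T' W' Z')

theorem fr_injective : Function.Injective S.fr := by
  intro i j h
  by_contra hij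
  have h1 := S.len_fr i j
  rw [h, S.len_self] at h1
  exact hij (framePos_injective (sub_eq_zero.1 (norm_eq_zero.1 h1.symm)))

/-- The distances of `c` from the frame vertices. -/
def frameLen (c : ℂ) : S.V → ℝ := Function.extend S.fr (fun i => ‖c - framePos i‖) 0

theorem frameLen_fr (c : ℂ) (i : Fin 3) : S.frameLen c (S.fr i) = ‖c - framePos i‖ :=
  S.fr_injective.extend_apply _ _ i

theorem exists_of_frameLen_ne_zero {c : ℂ} {v : S.V} (hv : S.frameLen c v ≠ 0) :
    ∃ i, v = S.fr i := by
  by_contra h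
  push Not at h
  exact hv (Function.extend_apply' _ _ _ fun ⟨i, hi⟩ => h i hi.symm)

theorem frameLen_nonneg (c : ℂ) (v : S.V) : 0 ≤ S.frameLen c v := by
  by_cases h : S.frameLen c v = 0
  · exact h.ge
  · obtain ⟨i, rfl⟩ := S.exists_of_frameLen_ne_zero h
    rw [frameLen_fr]; exact norm_nonneg _

end Frame

/-- Every constant can be computed. -/
theorem exists_const (S : Stage ι T W W) (c : ℂ) :
    ∃ S' : Stage ι T W W, S.Refines S' ∧ S'.Computes fun _ => c := by
  -- A frame point is already a vertex and must be treated apart, because length `0` encodes a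
  -- missing bar.
  by_cases hc : ∃ i, c = framePos i
  · obtain ⟨i, rfl⟩ := hc
    exact ⟨S, fun _ h => h, S.fr i, fun f x hx => (S.pt_config subset_rfl f hx).1 i⟩
  push Not at hc
  have hpos : ∀ i, 0 < ‖c - framePos i‖ := fun i => norm_pos_iff.2 (sub_ne_zero.2 (hc i))
  let S' : Stage ι T W W := S.extend (Z' := W) (W' := W) (T' := T) (S.frameLen c)
    (S.frameLen_nonneg c) ⟨S.fr 0, by rw [frameLen_fr]; exact (hpos 0).ne'⟩
    (fun _ _ h _ _ => h) subset_rfl subset_rfl S.F id (fun _ _ => c)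
    (fun _ => analyticOnNhd_const) (fun _ _ _ _ h _ => h)
    (by
      intro x hx _ f z
      have hfp := (S.pt_config subset_rfl f hx).1
      constructor
      · intro h
        refine ⟨hx, f, rfl, eq_of_frame_dist fun i => ?_⟩
        have := h (S.fr i) (by rw [frameLen_fr]; exact (hpos i).ne')
        rwa [frameLen_fr, hfp] at this
      · rintro ⟨-, -, -, rfl⟩ v hv
        obtain ⟨i, rfl⟩ := S.exists_of_frameLen_ne_zero hv
        rw [frameLen_fr, hfp])
    (fun i hi => Or.inl hi)
  refine ⟨S', refines_of_lifts (emb := some) fun f' => ⟨f', fun x u => rfl⟩, none, ?_⟩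
  exact fun f x hx => rfl

end Stage

/-! ### Compactness bounds and the Peaucellier inversor -/

theorem _root_.IsCompact.exists_pos_lt {X : Type*} [TopologicalSpace X] {W : Set X}
    (hW : IsCompact W) {g : X → ℝ} (hg : ContinuousOn g W) (h0 : ∀ x ∈ W, 0 < g x) :
    ∃ a > 0, ∀ x ∈ W, a < g x := by
  rcases W.eq_empty_or_nonempty with rfl | hne
  · exact ⟨1, one_pos, by simp⟩
  obtain ⟨x, hx, hm⟩ := hW.exists_isMinOn hne hg
  exact ⟨g x / 2, half_pos (h0 x hx), fun y hy => (half_lt_self (h0 x hx)).trans_le (hm hy)⟩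

theorem _root_.IsCompact.exists_lt {X : Type*} [TopologicalSpace X] {W : Set X}
    (hW : IsCompact W) {g : X → ℝ} (hg : ContinuousOn g W) : ∃ b > 0, ∀ x ∈ W, g x < b := by
  obtain ⟨b, hb⟩ := hW.bddAbove_image hg
  exact ⟨max b 0 + 1, by positivity, fun x hx =>
    ((hb ⟨x, hx, rfl⟩).trans (le_max_left _ _)).trans_lt (lt_add_one _)⟩

/-- Inversion of `Q` in the circle of squared radius `-c` around `P`. -/
def negInv (c : ℝ) (P Q : ℂ) : ℂ := P + c / (starRingEnd ℂ) (P - Q)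

theorem negInv_eq {c : ℝ} {P Q : ℂ} (h : P ≠ Q) :
    negInv c P Q = P + ((c / ‖P - Q‖ ^ 2 : ℝ) : ℂ) * (P - Q) := by
  have h0 : P - Q ≠ 0 := sub_ne_zero.2 h
  have h1 : (starRingEnd ℂ) (P - Q) ≠ 0 := (map_ne_zero _).2 h0
  have h2 : (starRingEnd ℂ) (P - Q) * (P - Q) = ((‖P - Q‖ ^ 2 : ℝ) : ℂ) := by
    rw [mul_comm, mul_conj, normSq_eq_norm_sq]
  have h3 : ((‖P - Q‖ ^ 2 : ℝ) : ℂ) ≠ 0 := by rw [← h2]; exact mul_ne_zero h1 h0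
  rw [negInv, add_right_inj, ofReal_div, ← h2]
  field_simp

/-- `Q` and its image lie on opposite sides of `P`, at distances `d` and `c / d`, and `(d + c / d)²
> 2c`. This uniform gap later allows an elbow to exclude the folded rhombus. -/
theorem norm_sub_negInv {c : ℝ} (hc : 0 < c) {P Q : ℂ} (h : P ≠ Q) :
    √c < ‖Q - negInv c P Q‖ := by
  have hd : 0 < ‖P - Q‖ := norm_pos_iff.2 (sub_ne_zero.2 h)
  have e : Q - negInv c P Q = -(((1 + c / ‖P - Q‖ ^ 2 : ℝ) : ℂ) * (P - Q)) := by
    rw [negInv_eq h]; push_cast; ring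
  rw [e, norm_neg, norm_mul, norm_real, Real.norm_of_nonneg (by positivity),
    Real.sqrt_lt' (by positivity)]
  have : ((1 + c / ‖P - Q‖ ^ 2) * ‖P - Q‖) ^ 2 =
      ‖P - Q‖ ^ 2 + 2 * c + (c / ‖P - Q‖) ^ 2 := by
    field_simp; ring
  rw [this]
  have h1 : 0 < ‖P - Q‖ ^ 2 := by positivity
  have h2 := sq_nonneg (c / ‖P - Q‖)
  linarith

/-- Power of a point: the circle of radius `l` about `A` passes through `Q`, and `P` has power `L² -
l²` with respect to it. Hence the line `PQ` meets this circle again at the inverse point. -/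
theorem norm_negInv_sub {L l : ℝ} (hl : 0 < l) {P Q A : ℂ} (h : P ≠ Q)
    (h1 : ‖A - P‖ = L) (h2 : ‖A - Q‖ = l) : ‖negInv (l ^ 2 - L ^ 2) P Q - A‖ = l := by
  have hd : 0 < ‖P - Q‖ := norm_pos_iff.2 (sub_ne_zero.2 h)
  have e : negInv (l ^ 2 - L ^ 2) P Q - A =
      -((A - P) - (((l ^ 2 - L ^ 2) / ‖P - Q‖ ^ 2 : ℝ) : ℂ) * (P - Q)) := by
    rw [negInv_eq h]; ring
  rw [e, norm_neg, ← sq_eq_sq₀ (norm_nonneg _) hl.le]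
  have h1' : (A - P).re * (A - P).re + (A - P).im * (A - P).im = L ^ 2 := by
    rw [← normSq_apply, normSq_eq_norm_sq, h1]
  have h2' : (A - Q).re * (A - Q).re + (A - Q).im * (A - Q).im = l ^ 2 := by
    rw [← normSq_apply, normSq_eq_norm_sq, h2]
  have hd' : (P - Q).re * (P - Q).re + (P - Q).im * (P - Q).im = ‖P - Q‖ ^ 2 := by
    rw [← normSq_apply, normSq_eq_norm_sq]
  rw [← normSq_eq_norm_sq, normSq_apply]
  generalize ht : (l ^ 2 - L ^ 2) / ‖P - Q‖ ^ 2 = t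
  have ht' : l ^ 2 - L ^ 2 = t * ‖P - Q‖ ^ 2 := by rw [← ht]; field_simp
  rw [← hd'] at ht'
  simp only [sub_re, sub_im, mul_re, mul_im, ofReal_re, ofReal_im, zero_mul, sub_zero, add_zero]
    at *
  linear_combination (1 + t) * h1' - t * h2' - (1 + t) * ht'

/-- Two circles with distinct centres share at most two points, and `Q` and its inverse are already
two distinct common points. -/
theorem rhombus_iff {L l c : ℝ} (hl : 0 < l) (hc : c = l ^ 2 - L ^ 2) (hc0 : 0 < c)
    {P Q A B : ℂ} (h : P ≠ Q) (hAB : A ≠ B)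
    (hA : ‖A - P‖ = L ∧ ‖A - Q‖ = l) (hB : ‖B - P‖ = L ∧ ‖B - Q‖ = l) (z : ℂ) :
    (‖z - A‖ = l ∧ ‖z - B‖ = l) ↔ z = Q ∨ z = negInv c P Q := by
  have hQ : Q ≠ negInv c P Q := by
    intro e
    have := norm_sub_negInv hc0 h
    rw [← e, sub_self, norm_zero] at this
    exact absurd (Real.sqrt_nonneg c) (not_le.2 this)
  have hA' := norm_negInv_sub hl h hA.1 hA.2
  have hB' := norm_negInv_sub hl h hB.1 hB.2
  rw [← hc] at hA' hB'
  constructor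
  · rintro ⟨h1, h2⟩
    exact EuclideanGeometry.eq_of_dist_eq_of_dist_eq_of_finrank_eq_two
      Complex.finrank_real_complex hAB hQ (r₁ := l) (r₂ := l)
      (by rw [dist_comm, dist_eq_norm]; exact hA.2) (by rw [dist_eq_norm]; exact hA')
      (by rw [dist_eq_norm]; exact h1)
      (by rw [dist_comm, dist_eq_norm]; exact hB.2) (by rw [dist_eq_norm]; exact hB')
      (by rw [dist_eq_norm]; exact h2)
  · rintro (rfl | rfl)
    · rw [norm_sub_rev, hA.2, norm_sub_rev, hB.2]; exact ⟨rfl, rfl⟩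
    · exact ⟨hA', hB'⟩

namespace Stage

variable {ι : Type} [Fintype ι] {T : Set ι} {W : Set (ι → ℂ)}

/-- The Peaucellier inversor with two variable arguments. -/
theorem exists_negInv (S : Stage ι T W W) (hWc : IsCompact W) (hW : W.Nonempty) {c : ℝ}
    (hc : 0 < c) {h k : (ι → ℂ) → ℂ} (hh : S.Computes h) (hk : S.Computes k)
    (hne : ∀ x ∈ W, h x ≠ k x) :
    ∃ S' : Stage ι T W W, S.Refines S' ∧ S'.Computes fun x => negInv c (h x) (k x) := by
  have hcont : ContinuousOn (fun x => ‖h x - k x‖) W :=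
    (hh.continuousOn.sub hk.continuousOn).norm
  obtain ⟨a, ha, hda⟩ := hWc.exists_pos_lt hcont
    fun x hx => norm_pos_iff.2 (sub_ne_zero.2 (hne x hx))
  obtain ⟨b, hb, hdb⟩ := hWc.exists_lt hcont
  -- The arms will satisfy `l - L = ε` and `l + L = c / ε`, so that `l² - L² = c`. With `ε` small,
  -- every distance between `h x` and `k x` lies strictly between these two values.
  obtain ⟨ε, hε, hεa, hεb, hεc⟩ : ∃ ε > 0, ε < a ∧ b < c / ε ∧ ε < c / ε := by
    refine ⟨min (a / 2) (min (c / (2 * b)) (√c / 2)), by positivity, ?_, ?_, ?_⟩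
    · exact (min_le_left _ _).trans_lt (half_lt_self ha)
    · rw [lt_div_iff₀ (by positivity)]
      calc b * min (a / 2) (min (c / (2 * b)) (√c / 2)) ≤ b * (c / (2 * b)) := by
            gcongr; exact (min_le_right _ _).trans (min_le_left _ _)
        _ = c / 2 := by field_simp
        _ < c := half_lt_self hc
    · rw [lt_div_iff₀ (by positivity)]
      have : min (a / 2) (min (c / (2 * b)) (√c / 2)) ≤ √c / 2 :=
        (min_le_right _ _).trans (min_le_right _ _)
      calc _ ≤ √c / 2 * (√c / 2) := by gcongr
        _ = (√c * √c) / 4 := by ring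
        _ = c / 4 := by rw [Real.mul_self_sqrt hc.le]
        _ < c := by linarith
  obtain ⟨L, hL, hLe⟩ : ∃ L, 0 < L ∧ L = (c / ε - ε) / 2 := ⟨_, by linarith, rfl⟩
  obtain ⟨l, hl, hle⟩ : ∃ l, 0 < l ∧ l = (c / ε + ε) / 2 := ⟨_, by positivity, rfl⟩
  have hcl : c = l ^ 2 - L ^ 2 := by rw [hLe, hle]; field_simp; ring
  have hLl1 : |L - l| = ε := by
    rw [hLe, hle, show (c / ε - ε) / 2 - (c / ε + ε) / 2 = -ε by ring, abs_neg, abs_of_pos hε]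
  have hLl2 : L + l = c / ε := by rw [hLe, hle]; ring
  have hrange : ∀ x ∈ W, |L - l| < ‖h x - k x‖ ∧ ‖h x - k x‖ < L + l := fun x hx =>
    ⟨by rw [hLl1]; exact hεa.trans (hda x hx), by rw [hLl2]; exact (hdb x hx).trans hεb⟩
  have hD : ∀ x ∈ W, h x ≠ k x ∧ 0 < circleDisc L l (normSq (k x - h x)) := fun x hx =>
    disc_pos_of_dist (hrange x hx).1 (hrange x hx).2
  have hapex : ∀ b, ∀ x ∈ W, ‖apex L l b (h x) (k x) - h x‖ = L ∧
      ‖apex L l b (h x) (k x) - k x‖ = l := by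
    intro b x hx
    rw [mem_circles_iff hL hl (hD x hx).1 (hD x hx).2]
    cases b <;> simp
  obtain ⟨vP, hvP⟩ := hh
  obtain ⟨vQ, hvQ⟩ := hk
  -- the two opposite corners of the rhombus
  obtain ⟨S₁, e₁, A, l₁, m₁⟩ := S.exists_apex hW (v := vP) (w := vQ) hL hl (fun _ => True)
    ⟨S.neF.some, trivial⟩ (fun f _ x hx => by rw [hvP f x hx, hvQ f x hx]; exact hrange x hx)
    (fun f hf => absurd trivial hf)
  have L₁ : ∀ f', ∃ f, S.Lifts S₁ e₁ f f' := fun f' => by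
    obtain ⟨f, b, -, h, -⟩ := l₁ f'; exact ⟨f, h⟩
  have hvP₁ := computes_of_lifts L₁ hvP
  have hvQ₁ := computes_of_lifts L₁ hvQ
  obtain ⟨S₂, e₂, B, l₂, m₂⟩ := S₁.exists_apex hW (v := e₁ vP) (w := e₁ vQ) hL hl
    (fun _ => True) ⟨S₁.neF.some, trivial⟩
    (fun f _ x hx => by rw [hvP₁ f x hx, hvQ₁ f x hx]; exact hrange x hx)
    (fun f hf => absurd trivial hf)
  have L₂ : ∀ f', ∃ f, S₁.Lifts S₂ e₂ f f' := fun f' => by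
    obtain ⟨f, b, -, h, -⟩ := l₂ f'; exact ⟨f, h⟩
  have hvP₂ := computes_of_lifts L₂ hvP₁
  have hvQ₂ := computes_of_lifts L₂ hvQ₁
  -- separating the corners
  have cont : ∀ b, ContinuousOn (fun x => apex L l b (h x) (k x)) W := by
    intro b
    obtain ⟨f₀⟩ := S.neF
    obtain ⟨f₁, hl₁, hA₁⟩ := m₁ f₀ b trivial
    refine ((S₁.analytic f₁ A).continuousOn).congr fun x hx => ?_
    simp only [hA₁, hvP f₀ x hx, hvQ f₀ x hx]
  have cont' : ContinuousOn (fun x => ‖apex L l true (h x) (k x) - apex L l false (h x) (k x)‖) W :=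
    ((cont true).sub (cont false)).norm
  obtain ⟨ρ₁, hρ₁, hlow⟩ := hWc.exists_pos_lt cont'
    fun x hx => norm_pos_iff.2 (sub_ne_zero.2 (apex_true_ne_false (hD x hx).1 (hD x hx).2))
  obtain ⟨ρ₂, -, hupp⟩ := hWc.exists_lt cont'
  have hρ : ρ₁ < ρ₂ := by
    obtain ⟨x, hx⟩ := hW
    exact (hlow x hx).trans (hupp x hx)
  have shape₂ : ∀ f₂, ∃ b b', (∀ x ∈ W, S₂.pt f₂ x (e₂ A) = apex L l b (h x) (k x)) ∧
      (∀ x ∈ W, S₂.pt f₂ x B = apex L l b' (h x) (k x)) := by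
    intro f₂
    obtain ⟨f₁, b', -, hl₂, hB⟩ := l₂ f₂
    obtain ⟨f, b, -, hl₁, hA⟩ := l₁ f₁
    refine ⟨b, b', fun x hx => ?_, fun x hx => ?_⟩
    · rw [hl₂, hA, hvP f x hx, hvQ f x hx]
    · rw [hB, hvP₁ f₁ x hx, hvQ₁ f₁ x hx]
  -- The corners `A` and `B` were attached independently and may coincide, in which case they would
  -- not determine the fourth vertex. The elbow keeps only the branches with opposite corners.
  obtain ⟨S₃, e₃, l₃⟩ := S₂.exists_elbow hW (e₂ A) B hρ₁ hρ
    (fun f₂ => ∃ b, (∀ x ∈ W, S₂.pt f₂ x (e₂ A) = apex L l b (h x) (k x)) ∧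
      (∀ x ∈ W, S₂.pt f₂ x B = apex L l (!b) (h x) (k x)))
    (by
      obtain ⟨f₁, -, hA⟩ := m₁ S.neF.some true trivial
      obtain ⟨f₂, hl₂, hB⟩ := m₂ f₁ false trivial
      refine ⟨f₂, true, fun x hx => ?_, fun x hx => ?_⟩
      · rw [hl₂, hA, hvP _ x hx, hvQ _ x hx]
      · rw [hB, hvP₁ f₁ x hx, hvQ₁ f₁ x hx]; rfl)
    (by
      rintro f ⟨b, hA, hB⟩ x hx
      rw [hA x hx, hB x hx]
      cases b
      · rw [norm_sub_rev]; exact ⟨hlow x hx, hupp x hx⟩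
      · exact ⟨hlow x hx, hupp x hx⟩)
    (by
      intro f hf x hx
      obtain ⟨b, b', hA, hB⟩ := shape₂ f
      have : b = b' := by
        by_contra hbb
        refine hf ⟨b, hA, ?_⟩
        have : b' = !b := by cases b <;> cases b' <;> first | rfl | exact absurd rfl hbb
        rwa [← this]
      rw [hA x hx, hB x hx, this, sub_self, norm_zero]
      exact hρ₁)
  have L₃ : ∀ f', ∃ f, S₂.Lifts S₃ e₃ f f' := fun f' => by
    obtain ⟨f, -, h⟩ := l₃ f'; exact ⟨f, h⟩
  have hvP₃ := computes_of_lifts L₃ hvP₂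
  have hvQ₃ := computes_of_lifts L₃ hvQ₂
  have shape₃ : ∀ f₃, ∀ x ∈ W, S₃.pt f₃ x (e₃ (e₂ A)) ≠ S₃.pt f₃ x (e₃ B) ∧
      (‖S₃.pt f₃ x (e₃ (e₂ A)) - h x‖ = L ∧ ‖S₃.pt f₃ x (e₃ (e₂ A)) - k x‖ = l) ∧
      (‖S₃.pt f₃ x (e₃ B) - h x‖ = L ∧ ‖S₃.pt f₃ x (e₃ B) - k x‖ = l) := by
    intro f₃ x hx
    obtain ⟨f₂, ⟨b, hA, hB⟩, hl₃⟩ := l₃ f₃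
    rw [hl₃, hl₃, hA x hx, hB x hx]
    refine ⟨?_, hapex _ x hx, hapex _ x hx⟩
    have := apex_true_ne_false (hD x hx).1 (hD x hx).2
    cases b
    · exact this.symm
    · exact this
  -- the opposite vertex of the rhombus
  set P' := e₃ (e₂ (e₁ vP)) with hP'
  set Q' := e₃ (e₂ (e₁ vQ)) with hQ'
  obtain ⟨S₄, e₄, C, l₄, m₄⟩ := S₃.exists_addPair (v := e₃ (e₂ A)) (w := e₃ B)
    (by
      obtain ⟨x, hx⟩ := hW
      intro e
      exact (shape₃ S₃.neF.some x hx).1 (by rw [e])) hl hl (fun _ => True)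
    ⟨S₃.neF.some, trivial⟩
    (fun b f x => bif b then S₃.pt f x Q' else negInv c (S₃.pt f x P') (S₃.pt f x Q'))
    (by
      intro b f _ x hx
      cases b
      · refine (S₃.analytic f P' x hx).add (analyticAt_div analyticAt_const
          (analyticAt_conj ((S₃.analytic f P' x hx).sub (S₃.analytic f Q' x hx))) ?_)
        refine (map_ne_zero _).2 (sub_ne_zero.2 ?_)
        rw [hvP₃ f x hx, hvQ₃ f x hx]
        exact hne x hx
      · exact S₃.analytic f Q' x hx)
    (by
      intro f _ x hx
      simp only [cond_true, cond_false]
      rw [hvP₃ f x hx, hvQ₃ f x hx]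
      intro e
      have := norm_sub_negInv hc (hne x hx)
      rw [← e, sub_self, norm_zero] at this
      exact absurd (Real.sqrt_nonneg c) (not_le.2 this))
    (by
      intro f _ x hx z
      simp only [cond_true, cond_false]
      rw [hvP₃ f x hx, hvQ₃ f x hx]
      obtain ⟨h1, h2, h3⟩ := shape₃ f x hx
      exact rhombus_iff hl hcl hc (hne x hx) h1 h2 h3 z)
    (fun f hf => absurd trivial hf)
  have L₄ : ∀ f', ∃ f, S₃.Lifts S₄ e₄ f f' := fun f' => by
    obtain ⟨f, b, -, h, -⟩ := l₄ f'; exact ⟨f, h⟩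
  have hvQ₄ := computes_of_lifts L₄ hvQ₃
  have contQ : ContinuousOn (fun x => ‖k x - negInv c (h x) (k x)‖) W := by
    obtain ⟨f₀⟩ := S₃.neF
    obtain ⟨f₄, -, hC⟩ := m₄ f₀ false trivial
    refine (((S₄.analytic f₄ (e₄ Q')).continuousOn.sub
      (S₄.analytic f₄ C).continuousOn).norm).congr fun x hx => ?_
    simp only [Pi.sub_apply, hvQ₄ f₄ x hx, hC, cond_false, hvP₃ f₀ x hx, hvQ₃ f₀ x hx]
  obtain ⟨ρ₃, -, hupp₃⟩ := hWc.exists_lt contQ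
  have hρ₃ : √c < ρ₃ := by
    obtain ⟨x, hx⟩ := hW
    exact (norm_sub_negInv hc (hne x hx)).trans (hupp₃ x hx)
  -- This elbow excludes the folded rhombus, in which the fourth vertex returns to `Q`. Only the
  -- inverse point remains.
  obtain ⟨S₅, e₅, l₅⟩ := S₄.exists_elbow hW (e₄ Q') C (Real.sqrt_pos.2 hc) hρ₃
    (fun f => ∀ x ∈ W, S₄.pt f x C = negInv c (h x) (k x))
    (by
      obtain ⟨f₄, -, hC⟩ := m₄ S₃.neF.some false trivial
      refine ⟨f₄, fun x hx => ?_⟩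
      rw [hC, cond_false, hvP₃ _ x hx, hvQ₃ _ x hx])
    (by
      intro f hf x hx
      rw [hf x hx, hvQ₄ f x hx]
      exact ⟨norm_sub_negInv hc (hne x hx), hupp₃ x hx⟩)
    (by
      intro f hf x hx
      obtain ⟨f₃, b, -, -, hC⟩ := l₄ f
      cases b
      · refine absurd (fun y hy => ?_) hf
        rw [hC, cond_false, hvP₃ _ y hy, hvQ₃ _ y hy]
      · rw [hC, cond_true, hvQ₄ f x hx, hvQ₃ f₃ x hx, sub_self, norm_zero]
        exact Real.sqrt_pos.2 hc)
  have L₅ : ∀ f', ∃ f, S₄.Lifts S₅ e₅ f f' := fun f' => by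
    obtain ⟨f, -, h⟩ := l₅ f'; exact ⟨f, h⟩
  refine ⟨S₅, (((refines_of_lifts L₁).trans (refines_of_lifts L₂)).trans
    (refines_of_lifts L₃)).trans ((refines_of_lifts L₄).trans (refines_of_lifts L₅)),
    e₅ C, fun f x hx => ?_⟩
  obtain ⟨f₄, hf₄, hl⟩ := l₅ f
  rw [hl, hf₄ x hx]

end Stage

/-! ### Constructible functions -/

section Constructible

variable {ι : Type} [Fintype ι] {W : Set (ι → ℂ)}

/-- Every stage over `W` can be refined so as to compute `h`. -/
def Constructible (W : Set (ι → ℂ)) (h : (ι → ℂ) → ℂ) : Prop :=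
  ∀ S : Stage ι Set.univ W W, ∃ S' : Stage ι Set.univ W W, S.Refines S' ∧ S'.Computes h

namespace Constructible

variable {h k : (ι → ℂ) → ℂ}

theorem congr (hh : Constructible W h) (e : ∀ x ∈ W, h x = k x) : Constructible W k := by
  intro S
  obtain ⟨S', hS, v, hv⟩ := hh S
  exact ⟨S', hS, v, fun f x hx => (hv f x hx).trans (e x hx)⟩

theorem const (c : ℂ) : Constructible W fun _ => c := fun S => S.exists_const c

theorem input (i : ι) : Constructible W fun x => x i :=
  fun S => ⟨S, fun _ h => h, S.inp i, fun f x _ => S.pt_inp f x i⟩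

theorem exists_bound (hh : Constructible W h) (hWc : IsCompact W) :
    ∃ M > 0, ∀ x ∈ W, ‖h x‖ < M := by
  obtain ⟨S, -, hS⟩ := hh (Stage.initial ι W)
  exact hWc.exists_lt hS.continuousOn.norm

variable (hWc : IsCompact W) (hW : W.Nonempty)
include hWc hW

theorem negInv {c : ℝ} (hc : 0 < c) (hh : Constructible W h) (hk : Constructible W k)
    (hne : ∀ x ∈ W, h x ≠ k x) : Constructible W fun x => negInv c (h x) (k x) := by
  intro S
  obtain ⟨S₁, r₁, c₁⟩ := hh S
  obtain ⟨S₂, r₂, c₂⟩ := hk S₁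
  obtain ⟨S₃, r₃, c₃⟩ := S₂.exists_negInv hWc hW hc (r₂ _ c₁) c₂ hne
  exact ⟨S₃, (r₁.trans r₂).trans r₃, c₃⟩

/-- Two inversions with the same centre `h x` and constants `1` and `t` compose to the homothety of
ratio `t` about `h x`. The conjugations and the changes of side both cancel. -/
theorem lerp {t : ℝ} (ht : 0 < t) (hh : Constructible W h) (hk : Constructible W k)
    (hne : ∀ x ∈ W, h x ≠ k x) : Constructible W fun x => (1 - t) * h x + t * k x := by
  have e : ∀ x ∈ W, (starRingEnd ℂ) (h x - k x) ≠ 0 := fun x hx =>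
    (map_ne_zero _).2 (sub_ne_zero.2 (hne x hx))
  refine (negInv hWc hW ht hh (negInv hWc hW one_pos hh hk hne) ?_).congr ?_
  · intro x hx
    simpa [LinkageSpaces.negInv] using e x hx
  · intro x hx
    have := sub_ne_zero.2 (hne x hx)
    simp only [LinkageSpaces.negInv, sub_add_cancel_left, map_neg, map_div₀, ofReal_one, map_one,
      conj_conj]
    field_simp
    ring

theorem add_const (hk : Constructible W k) (t : ℂ) : Constructible W fun x => k x + t := by
  obtain ⟨M, hM, hkM⟩ := hk.exists_bound hWc
  -- The identity is `k + t = 2 * ((k + a) / 2) - (a - t)`. The auxiliary point `a` is so far out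
  -- that neither `lerp` meets coinciding points.
  set a : ℂ := ((M + 2 * ‖t‖ : ℝ) : ℂ) with ha
  have hna : ‖a‖ = M + 2 * ‖t‖ := by rw [ha, norm_real, Real.norm_of_nonneg (by positivity)]
  have h1 : ∀ x ∈ W, k x ≠ a := by
    intro x hx e
    have := hkM x hx
    rw [e, hna] at this
    linarith [norm_nonneg t]
  have h2 : ∀ x ∈ W, k x ≠ a - 2 * t := by
    intro x hx e
    have h3 := hkM x hx
    have h4 := norm_sub_norm_le a (2 * t)
    rw [← e, hna, norm_mul, norm_ofNat] at h4
    linarith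
  refine (lerp hWc hW two_pos (const (a - t)) (lerp hWc hW one_half_pos hk (const a) h1) ?_).congr
    ?_
  · intro x hx e
    refine h2 x hx ?_
    push_cast at e
    linear_combination -2 * e
  · intro x _
    push_cast
    ring

theorem add (hh : Constructible W h) (hk : Constructible W k) :
    Constructible W fun x => h x + k x := by
  obtain ⟨M, hM, hhM⟩ := hh.exists_bound hWc
  obtain ⟨N, hN, hkN⟩ := hk.exists_bound hWc
  -- The identity is `h + k = 2 * ((h + k + t) / 2) - t`. Here `|t|` exceeds `|h| + |k|`, which
  -- keeps both pairs of points apart.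
  set t : ℂ := ((M + N : ℝ) : ℂ) with ht
  have hnt : ‖t‖ = M + N := by rw [ht, norm_real, Real.norm_of_nonneg (by positivity)]
  have h1 : ∀ x ∈ W, h x ≠ k x + t := by
    intro x hx e
    have h3 := norm_sub_le (h x) (k x)
    rw [e, add_sub_cancel_left, ← e, hnt] at h3
    linarith [hhM x hx, hkN x hx]
  have h2 : ∀ x ∈ W, t ≠ h x + k x := by
    intro x hx e
    have h3 := norm_add_le (h x) (k x)
    rw [← e, hnt] at h3
    linarith [hhM x hx, hkN x hx]
  refine (lerp hWc hW two_pos (const t)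
    (lerp hWc hW one_half_pos hh (add_const hWc hW hk t) h1) ?_).congr ?_
  · intro x hx e
    refine h2 x hx ?_
    push_cast at e
    linear_combination 2 * e
  · intro x _
    push_cast
    ring

theorem neg (hk : Constructible W k) : Constructible W fun x => -k x := by
  obtain ⟨M, hM, hkM⟩ := hk.exists_bound hWc
  refine (add_const hWc hW (lerp hWc hW two_pos hk (const (M : ℂ)) ?_) (-(2 * M : ℂ))).congr ?_
  · intro x hx e
    have := hkM x hx
    rw [e, norm_real, Real.norm_of_nonneg hM.le] at this
    exact lt_irrefl _ this
  · intro x _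
    push_cast
    ring

theorem sub (hh : Constructible W h) (hk : Constructible W k) :
    Constructible W fun x => h x - k x :=
  (add hWc hW hh (neg hWc hW hk)).congr fun _ _ => (sub_eq_add_neg _ _).symm

/-- A homothety of ratio `t` about `M`, a point outside the range of `k`, followed by a translation.
-/
theorem pos_smul {t : ℝ} (ht : 0 < t) (hk : Constructible W k) :
    Constructible W fun x => t * k x := by
  obtain ⟨M, hM, hkM⟩ := hk.exists_bound hWc
  refine (add_const hWc hW (lerp hWc hW ht (const (M : ℂ)) hk ?_) (-((1 - t) * M : ℂ))).congr ?_
  · intro x hx e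
    have := hkM x hx
    rw [← e, norm_real, Real.norm_of_nonneg hM.le] at this
    exact lt_irrefl _ this
  · intro x _
    ring

theorem inv_conj (hk : Constructible W k) (h0 : ∀ x ∈ W, k x ≠ 0) :
    Constructible W fun x => ((starRingEnd ℂ) (k x))⁻¹ := by
  refine (neg hWc hW (negInv hWc hW one_pos (const 0) hk fun x hx => (h0 x hx).symm)).congr ?_
  intro x _
  simp [LinkageSpaces.negInv, inv_neg]

/-- Partial fractions: up to conjugation, `1 / (M - k) + 1 / (M + k) = 2M / (M² - k²)`. A second
conjugate reciprocal removes the conjugation and yields `k²`. -/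
theorem sq (hk : Constructible W k) : Constructible W fun x => k x ^ 2 := by
  obtain ⟨M, hM, hkM⟩ := hk.exists_bound hWc
  have hM0 : (M : ℂ) ≠ 0 := by exact_mod_cast hM.ne'
  have hn : ‖(M : ℂ)‖ = M := by rw [norm_real, Real.norm_of_nonneg hM.le]
  have h1 : ∀ x ∈ W, (M : ℂ) - k x ≠ 0 := by
    intro x hx e
    have := hkM x hx
    rw [← sub_eq_zero.1 e, hn] at this
    exact lt_irrefl _ this
  have h2 : ∀ x ∈ W, (M : ℂ) + k x ≠ 0 := by
    intro x hx e
    have := hkM x hx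
    rw [← norm_neg, ← eq_neg_of_add_eq_zero_left e, hn] at this
    exact lt_irrefl _ this
  have key : ∀ x ∈ W, ((starRingEnd ℂ) (M - k x))⁻¹ + ((starRingEnd ℂ) (M + k x))⁻¹ =
      (2 * M) * ((starRingEnd ℂ) ((M - k x) * (M + k x)))⁻¹ := by
    intro x hx
    have h1' := (map_ne_zero (starRingEnd ℂ)).2 (h1 x hx)
    have h2' := (map_ne_zero (starRingEnd ℂ)).2 (h2 x hx)
    rw [map_mul]
    field_simp
    simp only [map_sub, map_add, conj_ofReal]
    ring
  have h3 := inv_conj hWc hW (sub hWc hW (const (M : ℂ)) hk) h1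
  have h4 := inv_conj hWc hW (add hWc hW (const (M : ℂ)) hk) h2
  have h5 := inv_conj hWc hW (add hWc hW h3 h4) (by
    intro x hx
    rw [key x hx]
    exact mul_ne_zero (mul_ne_zero two_ne_zero hM0)
      (inv_ne_zero ((map_ne_zero _).2 (mul_ne_zero (h1 x hx) (h2 x hx)))))
  refine (sub hWc hW (const ((M : ℂ) ^ 2)) (pos_smul hWc hW (t := 2 * M) (by positivity) h5)).congr
    ?_
  intro x hx
  have e1 := h1 x hx
  have e2 := h2 x hx
  rw [key x hx, map_mul, map_inv₀, conj_conj]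
  push_cast
  simp only [map_mul, conj_ofReal, map_ofNat]
  field_simp
  ring

theorem mul (hh : Constructible W h) (hk : Constructible W k) :
    Constructible W fun x => h x * k x := by
  refine (pos_smul hWc hW one_half_pos (sub hWc hW (sq hWc hW (add hWc hW hh hk))
    (add hWc hW (sq hWc hW hh) (sq hWc hW hk)))).congr fun x _ => ?_
  push_cast
  ring

/-- Conjugation comes only together with a reciprocal, so the reciprocal has to be taken of
something real. For `w = k + M`, of positive real part, `u = w / (w + w̄)` is the conjugate
reciprocal of `1 + w / w̄`. Now `u (1 - u) = |w|² / (w + w̄)²` is real, and `w (1 - u)² / (u (1 -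
u)) = w̄`. -/
theorem conj (hk : Constructible W k) : Constructible W fun x => (starRingEnd ℂ) (k x) := by
  obtain ⟨M, hM, hkM⟩ := hk.exists_bound hWc
  set w : (ι → ℂ) → ℂ := fun x => k x + M with hwdef
  have hw : Constructible W w := add_const hWc hW hk M
  have hre : ∀ x ∈ W, 0 < (w x).re := by
    intro x hx
    have h1 := (abs_lt.1 ((abs_re_le_norm (k x)).trans_lt (hkM x hx))).1
    simp only [hwdef, add_re, ofReal_re]
    linarith
  have hw0 : ∀ x ∈ W, w x ≠ 0 := fun x hx e => by
    have := hre x hx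
    rw [e] at this
    simp at this
  have hw0' : ∀ x ∈ W, (starRingEnd ℂ) (w x) ≠ 0 := fun x hx => (map_ne_zero _).2 (hw0 x hx)
  have hs0 : ∀ x ∈ W, w x + (starRingEnd ℂ) (w x) ≠ 0 := by
    intro x hx
    rw [add_conj]
    exact_mod_cast (mul_pos two_pos (hre x hx)).ne'
  have hs0' : ∀ x ∈ W, (starRingEnd ℂ) (w x) + w x ≠ 0 := fun x hx => by
    rw [add_comm]; exact hs0 x hx
  have hu : Constructible W fun x => w x / (w x + (starRingEnd ℂ) (w x)) := by
    refine (inv_conj hWc hW (add hWc hW (const 1) (mul hWc hW hw (inv_conj hWc hW hw hw0)))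
      ?_).congr ?_
    · intro x hx
      have := hw0' x hx
      field_simp
      exact div_ne_zero (hs0' x hx) this
    · intro x hx
      have h1 := hw0 x hx
      have h2 := hw0' x hx
      have h3 := hs0 x hx
      simp only [map_add, map_one, map_mul, map_inv₀, conj_conj]
      field_simp
  have hu1 := sub hWc hW (const 1) hu
  have hv : Constructible W fun x => (starRingEnd ℂ) (w x) := by
    refine (mul hWc hW (mul hWc hW hw (sq hWc hW hu1))
      (inv_conj hWc hW (mul hWc hW hu hu1) ?_)).congr ?_
    · intro x hx
      have h1 := hw0 x hx
      have h2 := hw0' x hx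
      have h3 := hs0 x hx
      have : 1 - w x / (w x + (starRingEnd ℂ) (w x)) =
          (starRingEnd ℂ) (w x) / (w x + (starRingEnd ℂ) (w x)) := by
        field_simp
        ring
      rw [this]
      exact mul_ne_zero (div_ne_zero h1 h3) (div_ne_zero h2 h3)
    · intro x hx
      have h1 := hw0 x hx
      have h2 := hw0' x hx
      have h3 := hs0 x hx
      have h4 := hs0' x hx
      have : 1 - w x / (w x + (starRingEnd ℂ) (w x)) =
          (starRingEnd ℂ) (w x) / (w x + (starRingEnd ℂ) (w x)) := by
        field_simp
        ring
      rw [this]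
      simp only [map_add, map_mul, map_div₀, conj_conj]
      field_simp
      ring
  refine (add_const hWc hW hv (-(M : ℂ))).congr fun x _ => ?_
  simp [hwdef]

theorem re (hk : Constructible W k) : Constructible W fun x => ((k x).re : ℂ) := by
  refine (pos_smul hWc hW one_half_pos (add hWc hW hk (conj hWc hW hk))).congr fun x _ => ?_
  rw [add_conj]
  push_cast
  ring

theorem im (hk : Constructible W k) : Constructible W fun x => ((k x).im : ℂ) := by
  refine (re hWc hW (mul hWc hW (const (-I)) hk)).congr fun x _ => ?_
  simp

theorem sum {α : Type*} (s : Finset α) {g : α → (ι → ℂ) → ℂ}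
    (hg : ∀ a ∈ s, Constructible W (g a)) : Constructible W fun x => ∑ a ∈ s, g a x := by
  classical
  induction s using Finset.induction_on with
  | empty => simpa using const 0
  | insert a s ha ih =>
    refine (add hWc hW (hg a (Finset.mem_insert_self _ _))
      (ih fun b hb => hg b (Finset.mem_insert_of_mem hb))).congr fun x _ => ?_
    rw [Finset.sum_insert ha]

theorem of_dual (l : Module.Dual ℝ (ι → ℂ)) : Constructible W fun x => (l x : ℂ) := by
  classical
  have e : ∀ x, l x = ∑ i, ((x i).re * l (Pi.single i 1) + (x i).im * l (Pi.single i I)) := by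
    intro x
    conv_lhs => rw [← Finset.univ_sum_single x, map_sum]
    refine Finset.sum_congr rfl fun i _ => ?_
    rw [← smul_eq_mul, ← smul_eq_mul, ← map_smul, ← map_smul, ← map_add, ← Pi.single_smul,
      ← Pi.single_smul, ← Pi.single_add]
    congr 2
    simp
  refine (sum hWc hW Finset.univ fun i _ =>
    add hWc hW (mul hWc hW (re hWc hW (input i)) (const (l (Pi.single i 1) : ℂ)))
      (mul hWc hW (im hWc hW (input i)) (const (l (Pi.single i I) : ℂ)))).congr fun x _ => ?_
  rw [e]
  push_cast
  rfl

theorem of_isPolynomial {p : (ι → ℂ) → ℝ} (hp : IsPolynomial p) :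
    Constructible W fun x => (p x : ℂ) := by
  induction hp using Algebra.adjoin_induction with
  | mem p hp =>
    obtain ⟨l, rfl⟩ := hp
    exact of_dual hWc hW l
  | algebraMap r => exact (const (r : ℂ)).congr fun x _ => rfl
  | add p q _ _ hp hq => exact (add hWc hW hp hq).congr fun x _ => by simp
  | mul p q _ _ hp hq => exact (mul hWc hW hp hq).congr fun x _ => by simp

end Constructible

end Constructible

/-! ### Linkages for bounded zero sets -/

namespace Stage

variable {ι : Type} [Fintype ι]

/-- Configurations whose inputs with index in `T` lie in the disc of radius `R`. -/
def inputDisc (T : Set ι) (R : ℝ) : Set (ι → ℂ) := {x | ∀ i ∈ T, ‖x i‖ ≤ R}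

/-- A vertex held at `2 + i` by the frame is at distance `√(1 + p²)` from the vertex at `p + 2`, so
a bar of length `1` between them forces `p = 0`. -/
theorem exists_zeroSet {T : Set ι} {W : Set (ι → ℂ)} (hW : W.Nonempty) {p : (ι → ℂ) → ℝ}
    (hp : ∀ x, 0 ≤ p x) (S : Stage ι T W W) (hS : S.Computes fun x => (p x : ℂ) + 2) :
    Nonempty (Stage ι T W {x ∈ W | p x = 0}) := by
  classical
  obtain ⟨v, hv⟩ := hS
  have hre : ∀ i, (framePos i).re ≤ 1 := by
    intro i; fin_cases i <;> simp [framePos]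
  have him : ∀ i, (framePos i).im ≤ 1 := by
    intro i; fin_cases i <;> simp [framePos]
  -- The shift by `2` and `p ≥ 0` keep this vertex away from the frame, so the unit bar does not
  -- overwrite one of the frame bars.
  have hvf : ∀ i, S.fr i ≠ v := by
    rintro i rfl
    obtain ⟨x, hx⟩ := hW
    have h1 := hv S.neF.some x hx
    rw [(S.pt_config subset_rfl _ hx).1 i] at h1
    have h2 := congrArg re h1
    simp only [add_re, ofReal_re, re_ofNat] at h2
    linarith [hp x, hre i]
  set c : ℂ := 2 + I with hc
  have hpos : ∀ i, 0 < ‖c - framePos i‖ := by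
    intro i
    refine norm_pos_iff.2 fun e => ?_
    have h2 := congrArg Complex.re (sub_eq_zero.1 e)
    simp only [hc, add_re, re_ofNat, I_re] at h2
    linarith [hre i]
  have hfl : ∀ i, Function.update (S.frameLen c) v 1 (S.fr i) = ‖c - framePos i‖ := fun i => by
    rw [Function.update_of_ne (hvf i), frameLen_fr]
  have hnorm : ∀ y : ℝ, ‖c - (y + 2)‖ = 1 ↔ y = 0 := by
    intro y
    rw [← sq_eq_sq₀ (norm_nonneg _) zero_le_one, ← normSq_eq_norm_sq, normSq_apply]
    simp [hc]
  refine ⟨S.extend (Z' := {x ∈ W | p x = 0}) (W' := W) (T' := T)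
    (Function.update (S.frameLen c) v 1) ?_ ⟨v, by simp⟩
    (fun _ _ h _ _ => h) subset_rfl (fun x hx => hx.1) S.F id (fun _ _ => c)
    (fun _ => analyticOnNhd_const) (fun _ _ _ _ h _ => h) ?_ (fun i hi => Or.inl hi)⟩
  · intro u
    by_cases hu : u = v
    · rw [hu, Function.update_self]; exact zero_le_one
    · rw [Function.update_of_ne hu]; exact S.frameLen_nonneg c u
  · intro x hx _ f z
    have hfp := (S.pt_config subset_rfl f hx).1
    constructor
    · intro h
      obtain rfl : z = c := eq_of_frame_dist fun i => by
        have := h (S.fr i) (by rw [hfl]; exact (hpos i).ne')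
        rwa [hfl, hfp] at this
      have h1 := h v (by simp)
      rw [Function.update_self, hv f x hx, hnorm] at h1
      exact ⟨⟨hx, h1⟩, f, rfl, rfl⟩
    · rintro ⟨⟨-, hpx⟩, -, -, rfl⟩ u hu
      by_cases huv : u = v
      · rw [huv, Function.update_self, hv f x hx, hnorm]; exact hpx
      · rw [Function.update_of_ne huv] at hu ⊢
        obtain ⟨i, rfl⟩ := S.exists_of_frameLen_ne_zero hu
        rw [frameLen_fr, hfp]

/-- Two bars of length `R / 2` from the frame origin to the input `i` force `|x i| ≤ R`, which until
now was an assumption, and they connect the input to the frame. The strict bounds on `Z` keep the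
two elbow positions distinct and analytic. -/
theorem exists_anchor {T : Set ι} {Z : Set (ι → ℂ)} {R : ℝ} (hR : 0 < R)
    (i : ι) (hZ : ∀ x ∈ Z, ∀ j, 0 < ‖x j‖ ∧ ‖x j‖ < R)
    (S : Stage ι (insert i T) (inputDisc (insert i T) R) Z) :
    Nonempty (Stage ι T (inputDisc T R) Z) := by
  classical
  have hR2 : 0 < R / 2 := half_pos hR
  have hif := S.inp_ne_fr i 0
  have hZW : ∀ T : Set ι, Z ⊆ inputDisc T R := fun T x hx j _ => (hZ x hx j).2.le
  have hD : ∀ x ∈ Z, (0 : ℂ) ≠ x i ∧ 0 < circleDisc (R / 2) (R / 2) (normSq (x i - 0)) := by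
    intro x hx
    apply disc_pos_of_dist
    · rw [sub_self, abs_zero, zero_sub, norm_neg]; exact (hZ x hx i).1
    · rw [zero_sub, norm_neg, add_halves]; exact (hZ x hx i).2
  have hr : ∀ (g : S.V → ℝ), (∀ u, (if u = S.fr 0 then R / 2 else if u = S.inp i then R / 2 else 0)
      ≠ 0 → g u = (if u = S.fr 0 then R / 2 else if u = S.inp i then R / 2 else 0)) ↔
      (g (S.fr 0) = R / 2 ∧ g (S.inp i) = R / 2) := by
    intro g
    constructor
    · intro h
      have h1 := h (S.fr 0) (by simp [hR.ne'])
      have h2 := h (S.inp i) (by simp [hif, hR.ne'])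
      simp only [if_true, hif, if_false] at h1 h2
      exact ⟨h1, h2⟩
    · rintro ⟨h1, h2⟩ u hu
      split_ifs at hu ⊢ with hv hw
      · rw [hv, h1]
      · rw [hw, h2]
      · exact absurd rfl hu
  refine ⟨S.extend (Z' := Z) (W' := inputDisc T R) (T' := T)
    (fun u => if u = S.fr 0 then R / 2 else if u = S.inp i then R / 2 else 0)
    (fun u => by split_ifs <;> first | exact hR2.le | exact le_rfl) ⟨S.fr 0, by simp [hR.ne']⟩ ?_
    (hZW _) subset_rfl (S.F × Bool) Prod.fst
    (fun b x => apex (R / 2) (R / 2) b.2 0 (x i)) ?_ ?_ ?_ ?_⟩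
  · intro φ z hφ hfr hz j hj
    rcases hj with rfl | hj
    · obtain ⟨h1, h2⟩ := (hr fun u => ‖z - φ u‖).1 hz
      rw [hfr] at h1
      have h3 := norm_sub_le (z - framePos 0) (z - φ (S.inp j))
      rw [h1, h2, add_halves, sub_sub_sub_cancel_left] at h3
      simpa [framePos] using h3
    · exact hφ j hj
  · intro b x hx
    exact analyticAt_apex b.2 analyticAt_const
      ((ContinuousLinearMap.proj (R := ℝ) (φ := fun _ : ι => ℂ) i).analyticAt x)
      (hD x hx).1 (hD x hx).2
  · rintro ⟨f, b⟩ ⟨f', b'⟩ x hx h h'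
    obtain rfl : f = f' := h
    have := apex_true_ne_false (hD x hx).1 (hD x hx).2
    cases b <;> cases b' <;> first | rfl | exact absurd h' this | exact absurd h'.symm this
  · intro x hx _ f z
    rw [hr fun u => ‖z - S.pt f x u‖, (S.pt_config (hZW _) f hx).1, S.pt_inp]
    rw [show framePos 0 = 0 from rfl, mem_circles_iff hR2 hR2 (hD x hx).1 (hD x hx).2]
    constructor
    · rintro (h | h)
      · exact ⟨hx, (f, true), rfl, h⟩
      · exact ⟨hx, (f, false), rfl, h⟩
    · rintro ⟨-, ⟨f', b⟩, h, h'⟩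
      cases b
      · exact Or.inr h'
      · exact Or.inl h'
  · rintro j (rfl | hj)
    · exact Or.inr ⟨by simp [hR.ne'], by simp [hR.ne']⟩
    · exact Or.inl hj

/-- A bounded zero set of a nonnegative polynomial is the input space of a framed linkage. -/
theorem exists_of_isPolynomial {p : (ι → ℂ) → ℝ} (hp : IsPolynomial p) (hp0 : ∀ x, 0 ≤ p x)
    {R : ℝ} (hR : 0 < R) (hZ : ∀ x, p x = 0 → ∀ i, 0 < ‖x i‖ ∧ ‖x i‖ < R) :
    Nonempty (Stage ι ∅ Set.univ {x | p x = 0}) := by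
  classical
  have hWc : IsCompact (inputDisc (Set.univ : Set ι) R) := by
    have : inputDisc (Set.univ : Set ι) R = Set.pi Set.univ fun _ => Metric.closedBall 0 R := by
      ext x; simp [inputDisc]
    rw [this]
    exact isCompact_univ_pi fun _ => isCompact_closedBall _ _
  have hW : (inputDisc (Set.univ : Set ι) R).Nonempty := ⟨0, fun i _ => by simpa using hR.le⟩
  obtain ⟨S, -, hS⟩ := Constructible.add_const hWc hW
    (Constructible.of_isPolynomial hWc hW hp) 2 (Stage.initial ι _)
  have h1 := exists_zeroSet hW hp0 S hS
  have e : {x ∈ inputDisc (Set.univ : Set ι) R | p x = 0} = {x | p x = 0} := by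
    ext x
    exact ⟨fun h => h.2, fun h => ⟨fun i _ => (hZ x h i).2.le, h⟩⟩
  rw [e] at h1
  -- Inputs are anchored one at a time, until no assumption on them is left and the linkage is
  -- connected.
  have key : ∀ T : Finset ι, Nonempty (Stage ι (T : Set ι) (inputDisc (T : Set ι) R)
      {x | p x = 0}) → Nonempty (Stage ι ∅ Set.univ {x | p x = 0}) := by
    intro T
    induction T using Finset.induction_on with
    | empty =>
      intro h
      have : inputDisc ((∅ : Finset ι) : Set ι) R = Set.univ := by
        ext x; simp [inputDisc]
      rwa [this, Finset.coe_empty] at h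
    | insert i T _ ih =>
      rintro ⟨S⟩
      rw [Finset.coe_insert] at S
      exact ih (S.exists_anchor hR i hZ)
  exact key Finset.univ (by rwa [Finset.coe_univ])

end Stage

/-! ### Releasing the frame -/

section Unframe

variable {ι : Type} [Fintype ι] {Z Z' : Set (ι → ℂ)}

/-- An equivariant splitting of a set of planar configurations `Z` into a slice `Z'` and an
orientation preserving motion. -/
structure Splitting (Z Z' : Set (ι → ℂ)) where
  rot : (ι → ℂ) → ℂ
  trans : (ι → ℂ) → ℂ
  slice : (ι → ℂ) → ι → ℂ
  norm_rot : ∀ x ∈ Z, ‖rot x‖ = 1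
  slice_mem : ∀ x ∈ Z, slice x ∈ Z'
  eq : ∀ x ∈ Z, ∀ i, rot x * slice x i + trans x = x i
  unique : ∀ z ∈ Z', ∀ a b : ℂ, ‖a‖ = 1 → ∀ x : ι → ℂ, (∀ i, x i = a * z i + b) →
    x ∈ Z ∧ rot x = a ∧ trans x = b ∧ slice x = z
  conj_mem : ∀ x ∈ Z, (fun i => (starRingEnd ℂ) (x i)) ∈ Z
  analytic_rot : AnalyticOnNhd ℝ rot Z
  analytic_trans : AnalyticOnNhd ℝ trans Z
  analytic_slice : AnalyticOnNhd ℝ slice Z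

/-- Relative to the unit vector `e - o`, the third vertex is some `w` with `|w| = 1` and `|w - 1| =
|i - 1|`, hence `w = ± i`. -/
theorem exists_of_frame {o e u : ℂ} (h1 : ‖e - o‖ = 1) (h2 : ‖u - o‖ = 1)
    (h3 : ‖u - e‖ = ‖I - 1‖) : u = (e - o) * I + o ∨ u = -((e - o) * I) + o := by
  have h0 : e - o ≠ 0 := fun h => by simp [h] at h1
  have h1' : (starRingEnd ℂ) (e - o) * (e - o) = 1 := by
    rw [conj_mul', h1]; norm_num
  have h2' : ‖(u - o) * (starRingEnd ℂ) (e - o)‖ = 1 := by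
    rw [norm_mul, norm_conj, h1, h2, one_mul]
  have h3' : ‖(u - o) * (starRingEnd ℂ) (e - o) - 1‖ = ‖I - 1‖ := by
    rw [show (u - o) * (starRingEnd ℂ) (e - o) - 1 = (u - e) * (starRingEnd ℂ) (e - o) by
      linear_combination h1', norm_mul, norm_conj, h1, mul_one, h3]
  have h4 : u - o = (u - o) * (starRingEnd ℂ) (e - o) * (e - o) := by
    linear_combination (-(u - o)) * h1'
  generalize (u - o) * (starRingEnd ℂ) (e - o) = w at h2' h3' h4
  have e2 := congrArg (· ^ 2) h2'
  have e3 := congrArg (· ^ 2) h3'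
  simp only [← normSq_eq_norm_sq, normSq_apply] at e2 e3
  simp at e2 e3
  have hre : w.re = 0 := by linarith
  have him : (w.im - 1) * (w.im + 1) = 0 := by rw [hre] at e2; linarith
  rcases mul_eq_zero.1 him with h | h
  · have : w = I := Complex.ext hre (by simpa using sub_eq_zero.1 h)
    left
    rw [this] at h4
    linear_combination h4
  · have : w = -I := Complex.ext (by simpa using hre) (by simpa using eq_neg_of_add_eq_zero_left h)
    right
    rw [this] at h4
    linear_combination h4

variable (S : Stage ι ∅ Set.univ Z') (D : Splitting Z Z')

/-- The branches of the configuration space of an unframed linkage whose frame is positively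
oriented. -/
def Stage.orientedBranch (f : S.F) (x : ι → ℂ) (v : S.V) : ℂ :=
  D.rot x * S.pt f (D.slice x) v + D.trans x

/-- The branches of the configuration space of an unframed linkage. -/
def Stage.unframedBranch (j : S.F × Bool) (x : ι → ℂ) (v : S.V) : ℂ :=
  bif j.2 then S.orientedBranch D j.1 x v
  else (starRingEnd ℂ) (S.orientedBranch D j.1 (fun i => (starRingEnd ℂ) (x i)) v)

namespace Stage

variable {D}

theorem orientedBranch_inp (f : S.F) {x : ι → ℂ} (hx : x ∈ Z) (i : ι) :
    S.orientedBranch D f x (S.inp i) = x i := by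
  rw [orientedBranch, S.pt_inp, D.eq x hx]

theorem unframedBranch_inp (j : S.F × Bool) {x : ι → ℂ} (hx : x ∈ Z) (i : ι) :
    S.unframedBranch D j x (S.inp i) = x i := by
  rcases j with ⟨f, b⟩
  cases b
  · rw [unframedBranch, cond_false, S.orientedBranch_inp f (D.conj_mem x hx), conj_conj]
  · exact S.orientedBranch_inp f hx i

theorem orientedBranch_fr (f : S.F) {x : ι → ℂ} (hx : x ∈ Z) (i : Fin 3) :
    S.orientedBranch D f x (S.fr i) = D.rot x * framePos i + D.trans x := by
  rw [orientedBranch, (S.pt_config (Set.subset_univ _) f (D.slice_mem x hx)).1]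

theorem analytic_orientedBranch (f : S.F) (v : S.V) :
    AnalyticOnNhd ℝ (fun x => S.orientedBranch D f x v) Z := by
  intro x hx
  refine ((D.analytic_rot x hx).mul ?_).add (D.analytic_trans x hx)
  exact (S.analytic f v (D.slice x) (D.slice_mem x hx)).comp (D.analytic_slice x hx)

theorem analytic_unframedBranch (j : S.F × Bool) (v : S.V) :
    AnalyticOnNhd ℝ (fun x => S.unframedBranch D j x v) Z := by
  rcases j with ⟨f, b⟩
  cases b
  · intro x hx
    refine analyticAt_conj (AnalyticAt.comp (g := fun y => S.orientedBranch D f y v)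
      (f := fun (y : ι → ℂ) i => (starRingEnd ℂ) (y i))
      (S.analytic_orientedBranch f v _ (D.conj_mem x hx)) (AnalyticAt.pi fun i => ?_))
    exact analyticAt_conj
      ((ContinuousLinearMap.proj (R := ℝ) (φ := fun _ : ι => ℂ) i).analyticAt x)
  · exact S.analytic_orientedBranch f v

theorem orientedBranch_injective {f f' : S.F} {x : ι → ℂ} (hx : x ∈ Z)
    (h : S.orientedBranch D f x = S.orientedBranch D f' x) : f = f' := by
  refine S.sep f f' (D.slice x) (D.slice_mem x hx) (funext fun v => ?_)
  have h0 : D.rot x ≠ 0 := fun e => by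
    have := D.norm_rot x hx
    simp [e] at this
  exact mul_left_cancel₀ h0 (add_right_cancel (congrFun h v))

theorem unframedBranch_injective {j j' : S.F × Bool} {x : ι → ℂ} (hx : x ∈ Z)
    (h : S.unframedBranch D j x = S.unframedBranch D j' x) : j = j' := by
  -- Branches of different sign carry oppositely oriented frames, so they never agree.
  have mixed : ∀ f f', S.unframedBranch D (f, true) x ≠ S.unframedBranch D (f', false) x := by
    intro f f' h
    have e : ∀ i, S.orientedBranch D f x (S.fr i) = (starRingEnd ℂ)
        (S.orientedBranch D f' (fun i => (starRingEnd ℂ) (x i)) (S.fr i)) :=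
      fun i => congrFun h (S.fr i)
    simp only [S.orientedBranch_fr _ hx, S.orientedBranch_fr _ (D.conj_mem x hx), map_add,
      map_mul] at e
    have e0 := e 0
    have e1 := e 1
    have e2 := e 2
    simp [framePos] at e0 e1 e2
    have h0 : D.rot x * (2 * I) = 0 := by linear_combination e2 + I * e1 - (1 + I) * e0
    have h1 := D.norm_rot x hx
    rw [(mul_eq_zero.1 h0).resolve_right (mul_ne_zero two_ne_zero I_ne_zero)] at h1
    simp at h1
  rcases j with ⟨f, _ | _⟩ <;> rcases j' with ⟨f', _ | _⟩
  · have h1 : S.orientedBranch D f (fun i => (starRingEnd ℂ) (x i)) =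
        S.orientedBranch D f' (fun i => (starRingEnd ℂ) (x i)) :=
      funext fun v => (starRingEnd ℂ).injective (congrFun h v)
    rw [S.orientedBranch_injective (D.conj_mem x hx) h1]
  · exact absurd h.symm (mixed _ _)
  · exact absurd h (mixed _ _)
  · rw [S.orientedBranch_injective (f := f) (f' := f') hx h]

theorem orientedBranch_edges (f : S.F) {x : ι → ℂ} (hx : x ∈ Z) (v w : S.V)
    (h : S.len v w ≠ 0) :
    ‖S.orientedBranch D f x v - S.orientedBranch D f x w‖ = S.len v w := by
  rw [orientedBranch, orientedBranch, add_sub_add_right_eq_sub, ← mul_sub, norm_mul,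
    D.norm_rot x hx, one_mul]
  exact (S.pt_config (Set.subset_univ _) f (D.slice_mem x hx)).2 v w h

-- Undoing the motion of the frame gives a framed configuration. The field `unique` then identifies
-- that motion with the one read off from the inputs.
variable (D) in
theorem exists_orientedBranch {φ : S.V → ℂ} {a b : ℂ}
    (hφ : ∀ v w, S.len v w ≠ 0 → ‖φ v - φ w‖ = S.len v w) (ha : ‖a‖ = 1)
    (hfr : ∀ i, φ (S.fr i) = a * framePos i + b) :
    φ ∘ S.inp ∈ Z ∧ ∃ f, φ = S.orientedBranch D f (φ ∘ S.inp) := by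
  have ha0 : a ≠ 0 := fun e => by simp [e] at ha
  obtain ⟨hz, f, hf⟩ := (S.spec (fun v => (φ v - b) / a) (Set.mem_univ _)).1
    ⟨fun i => by simp only [hfr]; field_simp; ring, fun v w h => by
      rw [← sub_div, sub_sub_sub_cancel_right, norm_div, ha, div_one, hφ v w h]⟩
  obtain ⟨h1, h2, h3, h4⟩ := D.unique _ hz a b ha (φ ∘ S.inp) (fun i => by
    simp only [Function.comp_apply]; field_simp; ring)
  refine ⟨h1, f, funext fun v => ?_⟩
  rw [orientedBranch, h2, h3, h4, ← hf]
  field_simp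
  ring

-- The frame triangle is rigid, so its image is a moved copy of the reference frame or of its mirror
-- image. Complex conjugation reduces the second case to the first.
variable (D) in
theorem unframed_spec (φ : S.V → ℂ) :
    (∀ v w, S.len v w ≠ 0 → ‖φ v - φ w‖ = S.len v w) ↔
      φ ∘ S.inp ∈ Z ∧ ∃ j, φ = S.unframedBranch D j (φ ∘ S.inp) := by
  constructor
  · intro hφ
    have hfr : ∀ i j, ‖φ (S.fr i) - φ (S.fr j)‖ = ‖framePos i - framePos j‖ := by
      intro i j
      by_cases h : i = j
      · simp [h]
      · rw [hφ _ _ ?_, S.len_fr]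
        rw [S.len_fr]
        exact (norm_pos_iff.2 (sub_ne_zero.2 (framePos_injective.ne h))).ne'
    have h1 : ‖φ (S.fr 1) - φ (S.fr 0)‖ = 1 := by rw [hfr]; simp [framePos]
    have h2 : ‖φ (S.fr 2) - φ (S.fr 0)‖ = 1 := by rw [hfr]; simp [framePos]
    rcases exists_of_frame h1 h2 (hfr 2 1) with h | h
    · obtain ⟨hz, f, hf⟩ := S.exists_orientedBranch D (a := φ (S.fr 1) - φ (S.fr 0))
        (b := φ (S.fr 0)) hφ h1 (by
          intro i
          fin_cases i
          · simp [framePos]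
          · simp [framePos]
          · simpa [framePos] using h)
      exact ⟨hz, (f, true), hf⟩
    · obtain ⟨hz, f, hf⟩ := S.exists_orientedBranch D (φ := fun v => (starRingEnd ℂ) (φ v))
        (a := (starRingEnd ℂ) (φ (S.fr 1) - φ (S.fr 0)))
        (b := (starRingEnd ℂ) (φ (S.fr 0)))
        (fun v w hvw => by rw [← map_sub, norm_conj, hφ v w hvw]) (by rw [norm_conj, h1]) (by
          intro i
          fin_cases i
          · simp [framePos]
          · simp [framePos]
          · simpa [framePos] using congrArg (starRingEnd ℂ) h)
      have hz' := D.conj_mem _ hz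
      simp only [Function.comp_apply, conj_conj] at hz'
      refine ⟨hz', (f, false), funext fun v => ?_⟩
      rw [unframedBranch, cond_false]
      have := congrArg (starRingEnd ℂ) (congrFun hf v)
      rwa [conj_conj] at this
  · rintro ⟨hz, ⟨f, b⟩, hf⟩ v w h
    rw [hf]
    cases b
    · simp only [unframedBranch, cond_false]
      rw [← map_sub, norm_conj, S.orientedBranch_edges f (D.conj_mem _ hz) v w h]
    · exact S.orientedBranch_edges f hz v w h

end Stage

end Unframe

/-! ### Finite families of disjoint analytic sections -/

section Sections

open Filter Topology

/-- The index of the smallest member of a finite family of functions is locally constant where the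
minimum is strict. -/
theorem exists_argmin {Y J : Type*} [TopologicalSpace Y] [Finite J] [Nonempty J] (d : J → Y → ℝ) :
    ∃ idx : Y → J, ∀ y j, (∀ j', ContinuousAt (d j') y) → (∀ j', j' ≠ j → d j y < d j' y) →
      ∀ᶠ y' in 𝓝 y, idx y' = j := by
  classical
  refine ⟨fun y => if h : ∃ j, ∀ j', j' ≠ j → d j y < d j' y then h.choose
    else Classical.arbitrary J, fun y j hc hj => ?_⟩
  have : ∀ᶠ y' in 𝓝 y, ∀ j', j' ≠ j → d j y' < d j' y' := by
    rw [eventually_all]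
    intro j'
    by_cases h : j' = j
    · simp [h]
    · filter_upwards [(hc j).eventually_lt (hc j') (hj j' h)] with y' hy' _ using hy'
  filter_upwards [this] with y' hy'
  have h : ∃ j, ∀ j', j' ≠ j → d j y' < d j' y' := ⟨j, hy'⟩
  rw [dif_pos h]
  by_contra hne
  exact lt_asymm (hy' _ hne) (h.choose_spec j (Ne.symm hne))

variable {A B E J : Type*} [Fintype A] [Fintype B] [NormedAddCommGroup E] [NormedSpace ℝ E]
  [Finite J] [Nonempty J]

/-- The union of finitely many disjoint graphs of analytic maps is a product with a finite set of
real numbers. -/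
theorem exists_analyticIsomorphism_of_sections (Z : Set (A → E)) (C : Set (A ⊕ B → E))
    (b : J → (A → E) → B → E) (hb : ∀ j, AnalyticOnNhd ℝ (b j) Z)
    (hsep : ∀ x ∈ Z, ∀ j j', b j x = b j' x → j = j')
    (hC : C = {φ | ∃ x ∈ Z, ∃ j, φ = Sum.elim x (b j x)}) :
    ∃ F : Set ℝ, F.Finite ∧ F.Nonempty ∧ ∃ α : (A → E) × ℝ → B → E,
      IsAnalyticOnSubset (Z ×ˢ F) α ∧ C = {φ | ∃ x ∈ Z, ∃ f ∈ F, φ = Sum.elim x (α (x, f))} ∧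
      IsAnalyticIsomorphism (Z ×ˢ F) C (fun p => Sum.elim p.1 (α p)) := by
  obtain ⟨n, ⟨e⟩⟩ := Finite.exists_equiv_fin J
  -- Distinct integer labels are isolated in `ℝ`, so decoding a label is locally constant near each
  -- of them and `α` is analytic on a neighbourhood.
  let c : J → ℝ := fun j => ((e j : ℕ) : ℝ)
  have hc : Function.Injective c := fun j j' h => by
    have : (e j : ℕ) = e j' := Nat.cast_injective h
    exact e.injective (Fin.ext this)
  obtain ⟨dec, hdec⟩ := exists_argmin (Y := ℝ) (J := J) (fun j t => |t - c j|)
  have hdec' : ∀ j, ∀ᶠ t in 𝓝 (c j), dec t = j := by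
    intro j
    refine hdec (c j) j (fun j' => by fun_prop) fun j' h => ?_
    rw [sub_self, abs_zero]
    exact abs_pos.2 (sub_ne_zero.2 (hc.ne h.symm))
  have hdec0 : ∀ j, dec (c j) = j := fun j => (hdec' j).self_of_nhds
  let α : (A → E) × ℝ → B → E := fun p => b (dec p.2) p.1
  have hα : ∀ x j, α (x, c j) = b j x := fun x j => by simp only [α, hdec0]
  have hαa : AnalyticOnNhd ℝ α (Z ×ˢ Set.range c) := by
    rintro ⟨x, _⟩ ⟨hx, j, rfl⟩
    have h1 : AnalyticAt ℝ (fun p : (A → E) × ℝ => b j p.1) (x, c j) :=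
      AnalyticAt.comp (g := b j) (f := Prod.fst) (hb j x hx) analyticAt_fst
    refine h1.congr ?_
    filter_upwards [continuousAt_snd.eventually (hdec' j)] with p hp
    simp only [α, hp]
  have hgraph : AnalyticOnNhd ℝ (fun p : (A → E) × ℝ => Sum.elim p.1 (α p))
      (Z ×ˢ Set.range c) := by
    intro p hp
    rw [analyticAt_pi_iff]
    rintro (i | i)
    · exact (analyticAt_pi_iff.1 (analyticAt_fst (𝕜 := ℝ) (p := p))) i
    · exact (analyticAt_pi_iff.1 (hαa p hp)) i
  have hC' : C = {φ | ∃ x ∈ Z, ∃ f ∈ Set.range c, φ = Sum.elim x (α (x, f))} := by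
    rw [hC]
    ext φ
    constructor
    · rintro ⟨x, hx, j, h⟩
      exact ⟨x, hx, c j, ⟨j, rfl⟩, by rw [hα, h]⟩
    · rintro ⟨x, hx, _, ⟨j, rfl⟩, h⟩
      exact ⟨x, hx, j, by rw [h, hα]⟩
  let pr : (A ⊕ B → E) →L[ℝ] (A → E) :=
    ContinuousLinearMap.pi fun i => ContinuousLinearMap.proj (Sum.inl i)
  let pr' : (A ⊕ B → E) →L[ℝ] (B → E) :=
    ContinuousLinearMap.pi fun i => ContinuousLinearMap.proj (Sum.inr i)
  have hpr : ∀ x y, pr (Sum.elim x y) = x := fun _ _ => rfl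
  have hpr' : ∀ x y, pr' (Sum.elim x y) = y := fun _ _ => rfl
  -- The inverse recovers the branch as the nearest one. The graphs are disjoint, so the minimum is
  -- strict on `C` and the index is locally constant there.
  obtain ⟨idx, hidx⟩ := exists_argmin (J := J) (fun j φ => ‖pr' φ - b j (pr φ)‖)
  have hidx' : ∀ x ∈ Z, ∀ j, ∀ᶠ φ in 𝓝 (Sum.elim x (b j x)), idx φ = j := by
    intro x hx j
    refine hidx _ j (fun j' => ?_) fun j' h => ?_
    · have h1 : ContinuousAt (b j') (pr (Sum.elim x (b j x))) := by
        rw [hpr]; exact (hb j' x hx).continuousAt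
      exact (pr'.continuous.continuousAt.sub
        (ContinuousAt.comp (f := pr) h1 pr.continuous.continuousAt)).norm
    · rw [hpr, hpr', sub_self, norm_zero, norm_pos_iff, sub_ne_zero]
      exact fun e => h (hsep x hx j j' e).symm
  have hidx0 : ∀ x ∈ Z, ∀ j, idx (Sum.elim x (b j x)) = j := fun x hx j =>
    (hidx' x hx j).self_of_nhds
  have hmaps : Set.MapsTo (fun p : (A → E) × ℝ => Sum.elim p.1 (α p)) (Z ×ˢ Set.range c) C := by
    rintro ⟨x, _⟩ ⟨hx, j, rfl⟩
    rw [hC']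
    exact ⟨x, hx, c j, ⟨j, rfl⟩, rfl⟩
  have hinv : Set.InvOn (fun φ => (pr φ, c (idx φ)))
      (fun p : (A → E) × ℝ => Sum.elim p.1 (α p)) (Z ×ˢ Set.range c) C := by
    constructor
    · rintro ⟨x, _⟩ ⟨hx, j, rfl⟩
      simp only [hα, hpr, hidx0 x hx]
    · intro φ hφ
      rw [hC] at hφ
      obtain ⟨x, hx, j, rfl⟩ := hφ
      simp only [hpr, hidx0 x hx, hα]
  have hmaps' : Set.MapsTo (fun φ => (pr φ, c (idx φ))) C (Z ×ˢ Set.range c) := by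
    intro φ hφ
    rw [hC] at hφ
    obtain ⟨x, hx, j, rfl⟩ := hφ
    exact ⟨by simpa only [hpr] using hx, Set.mem_range_self _⟩
  refine ⟨Set.range c, Set.finite_range c, Set.range_nonempty c, α, ⟨α, hαa, fun _ _ => rfl⟩, hC',
    hinv.bijOn hmaps hmaps', ⟨_, hgraph, fun _ _ => rfl⟩, _, ?_, hinv⟩
  intro φ hφ
  rw [hC] at hφ
  obtain ⟨x, hx, j, rfl⟩ := hφ
  have h1 : AnalyticAt ℝ (fun φ => (pr φ, c j)) (Sum.elim x (b j x)) :=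
    (pr.analyticAt _).prod analyticAt_const
  refine h1.congr ?_
  filter_upwards [hidx' x hx j] with φ hφ
  rw [hφ]

end Sections

/-! ### Polynomial maps -/

section Polynomial

variable {E E' F G : Type*} [AddCommGroup E] [Module ℝ E] [AddCommGroup E'] [Module ℝ E']
  [AddCommGroup F] [Module ℝ F] [AddCommGroup G] [Module ℝ G]

namespace IsPolynomial

theorem dual (l : Module.Dual ℝ E) : IsPolynomial fun x => l x :=
  Algebra.subset_adjoin ⟨l, rfl⟩

theorem const (c : ℝ) : IsPolynomial fun _ : E => c :=
  Subalgebra.algebraMap_mem _ c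

theorem add {p q : E → ℝ} (hp : IsPolynomial p) (hq : IsPolynomial q) :
    IsPolynomial fun x => p x + q x :=
  Subalgebra.add_mem _ hp hq

theorem mul {p q : E → ℝ} (hp : IsPolynomial p) (hq : IsPolynomial q) :
    IsPolynomial fun x => p x * q x :=
  Subalgebra.mul_mem _ hp hq

theorem sub {p q : E → ℝ} (hp : IsPolynomial p) (hq : IsPolynomial q) :
    IsPolynomial fun x => p x - q x :=
  Subalgebra.sub_mem _ hp hq

theorem neg {p : E → ℝ} (hp : IsPolynomial p) : IsPolynomial fun x => -p x :=
  Subalgebra.neg_mem _ hp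

theorem pow {p : E → ℝ} (hp : IsPolynomial p) (n : ℕ) : IsPolynomial fun x => p x ^ n :=
  Subalgebra.pow_mem _ hp n

theorem sum {α : Type*} (s : Finset α) {p : α → E → ℝ} (hp : ∀ a ∈ s, IsPolynomial (p a)) :
    IsPolynomial fun x => ∑ a ∈ s, p a x := by
  have := Subalgebra.sum_mem (Algebra.adjoin ℝ (Set.range fun l : Module.Dual ℝ E => (l : E → ℝ)))
    (t := s) (f := p) hp
  unfold IsPolynomial
  convert this using 1
  ext x
  simp

theorem isEntireRational {p : E → ℝ} (hp : IsPolynomial p) : IsEntireRational p :=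
  ⟨p, fun _ => 1, hp, const 1, fun _ => one_ne_zero, fun _ => (div_one _).symm⟩

end IsPolynomial

/-- A vector valued map with polynomial coordinates. -/
def IsPolynomialMap (f : E → F) : Prop := ∀ l : Module.Dual ℝ F, IsPolynomial fun x => l (f x)

namespace IsPolynomialMap

theorem isEntireRationalMap {f : E → F} (hf : IsPolynomialMap f) : IsEntireRationalMap f :=
  fun l => (hf l).isEntireRational

theorem linear (f : E →ₗ[ℝ] F) : IsPolynomialMap fun x => f x :=
  fun l => IsPolynomial.dual (l.comp f)

theorem const (c : F) : IsPolynomialMap fun _ : E => c := fun l => IsPolynomial.const (l c)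

theorem sub {f g : E → F} (hf : IsPolynomialMap f) (hg : IsPolynomialMap g) :
    IsPolynomialMap fun x => f x - g x := fun l => by
  simp only [map_sub]
  exact (hf l).sub (hg l)

theorem of_isPolynomial {p : E → ℝ} (hp : IsPolynomial p) : IsPolynomialMap p := fun l => by
  have : (fun x => l (p x)) = fun x => l 1 * p x := funext fun x => by
    conv_lhs => rw [← mul_one (p x), ← smul_eq_mul, map_smul, smul_eq_mul, mul_comm]
  rw [this]
  exact (IsPolynomial.const _).mul hp

theorem linear_comp {f : E → F} (hf : IsPolynomialMap f) (g : F →ₗ[ℝ] G) :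
    IsPolynomialMap fun x => g (f x) := fun l => hf (l.comp g)

theorem comp_isPolynomial {f : E → F} (hf : IsPolynomialMap f) {p : F → ℝ} (hp : IsPolynomial p) :
    IsPolynomial fun x => p (f x) := by
  induction hp using Algebra.adjoin_induction with
  | mem p hp =>
    obtain ⟨l, rfl⟩ := hp
    exact hf l
  | algebraMap r => exact IsPolynomial.const r
  | add p q _ _ hp hq => exact hp.add hq
  | mul p q _ _ hp hq => exact hp.mul hq

theorem prodMk {f : E → F} {g : E → G} (hf : IsPolynomialMap f) (hg : IsPolynomialMap g) :
    IsPolynomialMap fun x => (f x, g x) := fun l => by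
  have : ∀ x, l (f x, g x) = l.comp (LinearMap.inl ℝ F G) (f x) +
      l.comp (LinearMap.inr ℝ F G) (g x) := fun x => by
    simp [← map_add]
  simp only [this]
  exact (hf _).add (hg _)

theorem pi {α : Type*} [Finite α] {f : E → α → F} (hf : ∀ a, IsPolynomialMap fun x => f x a) :
    IsPolynomialMap f := fun l => by
  classical
  have := Fintype.ofFinite α
  have : ∀ x, l (f x) = ∑ a, l.comp (LinearMap.single ℝ (fun _ => F) a) (f x a) := fun x => by
    conv_lhs => rw [← Finset.univ_sum_single (f x), map_sum]
    rfl
  simp only [this]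
  exact IsPolynomial.sum _ fun a _ => hf a _

theorem toLp {n : ℕ} {f : E → Fin n → ℝ} (hf : ∀ i, IsPolynomial fun x => f x i) :
    IsPolynomialMap fun x => (WithLp.toLp 2 (f x) : R n) :=
  (pi fun i => of_isPolynomial (hf i)).linear_comp
    (WithLp.linearEquiv 2 ℝ (Fin n → ℝ)).symm.toLinearMap

theorem matrix {n : ℕ} {f : E → Matrix (Fin n) (Fin n) ℝ}
    (hf : ∀ i j, IsPolynomial fun x => f x i j) : IsPolynomialMap f :=
  pi (f := f) fun i => pi (f := fun x => f x i) fun j => of_isPolynomial (hf i j)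

end IsPolynomialMap

theorem IsPolynomial.coord {n : ℕ} {f : E → R n} (hf : IsPolynomialMap f) (i : Fin n) :
    IsPolynomial fun x => f x i :=
  hf ((LinearMap.proj i).comp (WithLp.linearEquiv 2 ℝ (Fin n → ℝ)).toLinearMap)

end Polynomial

/-! ### Analyticity of polynomials, and algebraic sets as zero sets of a single polynomial -/

section Analytic

variable {E : Type*} [NormedAddCommGroup E] [NormedSpace ℝ E] [FiniteDimensional ℝ E]

theorem IsPolynomial.analyticAt {p : E → ℝ} (hp : IsPolynomial p) (x : E) : AnalyticAt ℝ p x := by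
  induction hp using Algebra.adjoin_induction with
  | mem p hp =>
    obtain ⟨l, rfl⟩ := hp
    exact (LinearMap.toContinuousLinearMap l).analyticAt x
  | algebraMap r => exact analyticAt_const
  | add p q _ _ hp hq => exact hp.add hq
  | mul p q _ _ hp hq => exact hp.mul hq

theorem IsEntireRational.analyticAt {p : E → ℝ} (hp : IsEntireRational p) (x : E) :
    AnalyticAt ℝ p x := by
  obtain ⟨p, q, hp, hq, h0, h⟩ := hp
  rw [funext h]
  exact (hp.analyticAt x).div (hq.analyticAt x) (h0 x)

theorem IsAlgebraicSet.isClosed {X : Set E} (hX : IsAlgebraicSet X) : IsClosed X := by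
  obtain ⟨S, hS, rfl⟩ := hX
  have : {x | ∀ p ∈ S, p x = 0} = ⋂ p ∈ S, {x | p x = 0} := by ext; simp
  rw [this]
  refine isClosed_biInter fun p hp => isClosed_eq ?_ continuous_const
  exact continuous_iff_continuousAt.2 fun x => ((hS p hp).analyticAt x).continuousAt

end Analytic

/-- A real algebraic set is the zero set of one nonnegative polynomial. -/
theorem IsAlgebraicSet.exists_nonneg {E : Type*} [AddCommGroup E] [Module ℝ E]
    [FiniteDimensional ℝ E] {X : Set E} (hX : IsAlgebraicSet X) :
    ∃ p : E → ℝ, IsPolynomial p ∧ (∀ x, 0 ≤ p x) ∧ X = {x | p x = 0} := by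
  obtain ⟨S, hS, hXS⟩ := hX
  let b := Module.finBasis ℝ E
  let ev : MvPolynomial (Fin (Module.finrank ℝ E)) ℝ →ₐ[ℝ] (E → ℝ) :=
    MvPolynomial.aeval fun i x => b.coord i x
  have hev : ∀ P, IsPolynomial (ev P) := by
    intro P
    induction P using MvPolynomial.induction_on with
    | C a => rw [MvPolynomial.algHom_C]; exact IsPolynomial.const a
    | add P Q hP hQ => rw [map_add]; exact hP.add hQ
    | mul_X P i hP =>
      rw [map_mul, MvPolynomial.aeval_X]
      exact hP.mul (IsPolynomial.dual (b.coord i))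
  have hsurj : ∀ p : E → ℝ, IsPolynomial p → ∃ P, ev P = p := by
    intro p hp
    refine Algebra.adjoin_le (S := ev.range) ?_ hp
    rintro _ ⟨l, rfl⟩
    refine ⟨∑ i, MvPolynomial.C (l (b i)) * MvPolynomial.X i, funext fun x => ?_⟩
    rw [AlgHom.toRingHom_eq_coe, RingHom.coe_coe, map_sum, Finset.sum_apply]
    conv_rhs => rw [← b.sum_repr x]
    change _ = l _
    rw [map_sum]
    refine Finset.sum_congr rfl fun i _ => ?_
    rw [map_mul, MvPolynomial.algHom_C, MvPolynomial.aeval_X, map_smul, smul_eq_mul, mul_comm]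
    rfl
  let J : Ideal (MvPolynomial (Fin (Module.finrank ℝ E)) ℝ) :=
    { carrier := {P | ∀ x ∈ X, ev P x = 0}
      add_mem' := fun {P Q} hP hQ x hx => by
        rw [map_add, Pi.add_apply, hP x hx, hQ x hx, add_zero]
      zero_mem' := fun x _ => by rw [map_zero, Pi.zero_apply]
      smul_mem' := fun P Q hQ x hx => by
        rw [smul_eq_mul, map_mul, Pi.mul_apply, hQ x hx, mul_zero] }
  -- By Hilbert's basis theorem the vanishing ideal of `X` has finitely many generators. Over `ℝ`
  -- the sum of their squares vanishes exactly where they all do.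
  obtain ⟨s, hs⟩ := (isNoetherianRing_iff_ideal_fg _).1 inferInstance J
  refine ⟨fun x => ∑ P ∈ s, ev P x ^ 2, IsPolynomial.sum _ fun P _ => (hev P).pow 2,
    fun x => Finset.sum_nonneg fun P _ => sq_nonneg _, ?_⟩
  ext x
  rw [Set.mem_ofPred_eq, Finset.sum_eq_zero_iff_of_nonneg fun P _ => sq_nonneg _]
  constructor
  · intro hx P hP
    have : P ∈ J := hs ▸ Ideal.subset_span hP
    rw [this x hx]
    norm_num
  · intro h
    rw [hXS]
    intro p hp
    obtain ⟨P, rfl⟩ := hsurj p (hS p hp)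
    have hPJ : P ∈ J := fun y hy => by
      rw [hXS] at hy
      exact hy _ hp
    rw [← hs] at hPJ
    refine Submodule.span_induction (p := fun P _ => ev P x = 0) ?_ ?_ ?_ ?_ hPJ
    · intro Q hQ
      exact pow_eq_zero_iff two_ne_zero |>.1 (h Q hQ)
    · rw [map_zero, Pi.zero_apply]
    · intro P Q _ _ hP hQ
      rw [map_add, Pi.add_apply, hP, hQ, add_zero]
    · intro a P _ hP
      rw [smul_eq_mul, map_mul, Pi.mul_apply, hP, mul_zero]

/-! ### Plane motions in complex notation -/

/-- The isometry between the complex numbers and the Euclidean plane. -/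
def toPlane : ℂ ≃ₗᵢ[ℝ] R 2 := orthonormalBasisOneI.repr

theorem toPlane_apply_zero (z : ℂ) : toPlane z 0 = z.re := by
  rw [toPlane, orthonormalBasisOneI_repr_apply]; rfl

theorem toPlane_apply_one (z : ℂ) : toPlane z 1 = z.im := by
  rw [toPlane, orthonormalBasisOneI_repr_apply]; rfl

theorem toPlane_symm_apply (x : R 2) : toPlane.symm x = x 0 + x 1 * I :=
  orthonormalBasisOneI_repr_symm_apply x

/-- The matrix of multiplication by `a`. -/
def mulMatrix (a : ℂ) : Matrix (Fin 2) (Fin 2) ℝ := !![a.re, -a.im; a.im, a.re]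

theorem mulMatrix_mem {a : ℂ} (ha : ‖a‖ = 1) :
    mulMatrix a ∈ Matrix.specialOrthogonalGroup (Fin 2) ℝ := by
  have h := congrArg (· ^ 2) ha
  simp only [← normSq_eq_norm_sq, normSq_apply] at h
  rw [Matrix.mem_specialOrthogonalGroup_iff, Matrix.mem_orthogonalGroup_iff]
  constructor
  · ext i j
    fin_cases i <;> fin_cases j <;>
      simp [mulMatrix, Matrix.mul_apply, Fin.sum_univ_two] <;>
      linarith
  · rw [mulMatrix, Matrix.det_fin_two_of]
    linarith

/-- Orthonormal columns and determinant `1` make the second column the quarter turn of the first. -/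
theorem exists_mulMatrix {Q : Matrix (Fin 2) (Fin 2) ℝ}
    (hQ : Q ∈ Matrix.specialOrthogonalGroup (Fin 2) ℝ) :
    ‖(⟨Q 0 0, Q 1 0⟩ : ℂ)‖ = 1 ∧ Q = mulMatrix ⟨Q 0 0, Q 1 0⟩ := by
  rw [Matrix.mem_specialOrthogonalGroup_iff, Matrix.mem_orthogonalGroup_iff'] at hQ
  obtain ⟨h1, h2⟩ := hQ
  rw [Matrix.det_fin_two] at h2
  have h00 := congrFun (congrFun h1 0) 0
  have h01 := congrFun (congrFun h1 0) 1
  have h11 := congrFun (congrFun h1 1) 1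
  simp [Matrix.mul_apply, Fin.sum_univ_two] at h00 h01 h11
  have e1 : Q 1 1 = Q 0 0 := by
    linear_combination (-Q 1 1) * h00 + Q 1 0 * h01 + Q 0 0 * h2
  have e2 : Q 0 1 = -Q 1 0 := by
    linear_combination (-Q 0 1) * h00 + Q 0 0 * h01 - Q 1 0 * h2
  constructor
  · rw [← sq_eq_sq₀ (norm_nonneg _) zero_le_one, ← normSq_eq_norm_sq, normSq_mk, h00]
    norm_num
  · ext i j
    fin_cases i <;> fin_cases j <;> simp [mulMatrix, e1, e2]

theorem act_mulMatrix {V : Type*} (a b : ℂ) (z : V → R 2) (v : V) :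
    act (mulMatrix a, toPlane b) z v = toPlane (a * toPlane.symm (z v) + b) := by
  ext i
  rw [toPlane_symm_apply]
  fin_cases i
  · simp [act, toPlane_apply_zero, mulMatrix, dotProduct, Fin.sum_univ_two]
    ring
  · simp [act, toPlane_apply_one, mulMatrix, dotProduct, Fin.sum_univ_two]
    ring

/-! ### Configuration spaces of linkages without fixed vertices are split -/

theorem IsPolynomialMap.complex {E : Type*} [AddCommGroup E] [Module ℝ E] {f : E → ℂ}
    (hre : IsPolynomial fun x => (f x).re) (him : IsPolynomial fun x => (f x).im) :
    IsPolynomialMap f := fun l => by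
  have : (fun x => l (f x)) = fun x => (f x).re * l 1 + (f x).im * l I := funext fun x => by
    rw [← smul_eq_mul, ← smul_eq_mul, ← map_smul, ← map_smul, ← map_add]
    congr 1
    simp
  rw [this]
  exact (hre.mul (IsPolynomial.const _)).add (him.mul (IsPolynomial.const _))

theorem IsPolynomialMap.re {E : Type*} [AddCommGroup E] [Module ℝ E] {f : E → ℂ}
    (hf : IsPolynomialMap f) : IsPolynomial fun x => (f x).re := hf reLm

theorem IsPolynomialMap.im {E : Type*} [AddCommGroup E] [Module ℝ E] {f : E → ℂ}
    (hf : IsPolynomialMap f) : IsPolynomial fun x => (f x).im := hf imLm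

theorem IsPolynomialMap.complex_mul {E : Type*} [AddCommGroup E] [Module ℝ E] {f g : E → ℂ}
    (hf : IsPolynomialMap f) (hg : IsPolynomialMap g) : IsPolynomialMap fun x => f x * g x := by
  refine IsPolynomialMap.complex ?_ ?_
  · simp only [mul_re]
    exact (hf.re.mul hg.re).sub (hf.im.mul hg.im)
  · simp only [mul_im]
    exact (hf.re.mul hg.im).add (hf.im.mul hg.re)

theorem IsPolynomialMap.mulMatrix {E : Type*} [AddCommGroup E] [Module ℝ E] {f : E → ℂ}
    (hf : IsPolynomialMap f) : IsPolynomialMap fun x => mulMatrix (f x) := by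
  refine IsPolynomialMap.matrix fun i j => ?_
  fin_cases i <;> fin_cases j
  · exact hf.re
  · exact hf.im.neg
  · exact hf.im
  · exact hf.re

theorem isPolynomialMap_act {n : ℕ} {V : Type*} [Finite V] :
    IsPolynomialMap fun p : (V → R n) × AffineData n => act p.2 p.1 := by
  refine IsPolynomialMap.pi fun v => ?_
  have : (fun p : (V → R n) × AffineData n => act p.2 p.1 v) =
      fun p => WithLp.toLp 2 (fun i => ∑ j, p.2.1 i j * p.1 v j + p.2.2 i) := by
    funext p
    ext i
    simp [act, Matrix.mulVec, dotProduct]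
  rw [this]
  refine IsPolynomialMap.toLp fun i => ?_
  have hR : ∀ i, IsPolynomial fun x : R n => x i := fun i =>
    IsPolynomial.coord (IsPolynomialMap.linear LinearMap.id) i
  refine (IsPolynomial.sum _ fun j _ => IsPolynomial.mul ?_ ?_).add ?_
  · exact IsPolynomial.dual (((LinearMap.proj (R := ℝ) (φ := fun _ : Fin n => ℝ) j).comp
      (LinearMap.proj (R := ℝ) (φ := fun _ : Fin n => Fin n → ℝ) i)).comp
      ((LinearMap.fst ℝ (Fin n → Fin n → ℝ) (R n)).comp
        (LinearMap.snd ℝ (V → R n) ((Fin n → Fin n → ℝ) × R n))))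
  · exact IsPolynomial.coord (IsPolynomialMap.linear
      ((LinearMap.proj v).comp (LinearMap.fst ℝ (V → R n) (AffineData n)))) j
  · exact IsPolynomial.coord (IsPolynomialMap.linear
      ((LinearMap.snd ℝ _ (R n)).comp (LinearMap.snd ℝ (V → R n) (AffineData n)))) i

theorem isAlgebraicSet_forall {E α : Type*} [AddCommGroup E] [Module ℝ E] {p : α → E → ℝ}
    (hp : ∀ a, IsPolynomial (p a)) : IsAlgebraicSet {x | ∀ a, p a x = 0} :=
  ⟨Set.range p, by rintro _ ⟨a, rfl⟩; exact hp a, by ext; simp⟩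

theorem IsAlgebraicSet.inter {E : Type*} [AddCommGroup E] [Module ℝ E] {X Y : Set E}
    (hX : IsAlgebraicSet X) (hY : IsAlgebraicSet Y) : IsAlgebraicSet (X ∩ Y) := by
  obtain ⟨S, hS, rfl⟩ := hX
  obtain ⟨T, hT, rfl⟩ := hY
  refine ⟨S ∪ T, fun p hp => hp.elim (hS p) (hT p), ?_⟩
  ext x
  simp only [Set.mem_inter_iff, Set.mem_ofPred_eq, Set.mem_union, or_imp, forall_and]

theorem isPolynomialMap_eval {V F : Type*} [AddCommGroup F] [Module ℝ F] (v : V) :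
    IsPolynomialMap fun φ : V → F => φ v :=
  IsPolynomialMap.linear (LinearMap.proj (R := ℝ) (φ := fun _ : V => F) v)

theorem ClassicalLinkage.mem_configSpace {n : ℕ} {V : Type*} {L : ClassicalLinkage n V}
    (hL : L.fixed = ∅) {φ : V → R n} : φ ∈ L.configSpace ↔
      ∀ (v w : V) (h : L.graph.Adj v w), ‖φ v - φ w‖ = L.len ⟨s(v, w), h⟩ := by
  constructor
  · exact fun h => h.2
  · refine fun h => ⟨fun v => ?_, h⟩
    exact absurd (hL ▸ v.2 : (v : V) ∈ (∅ : Set V)) (Set.notMem_empty _)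

theorem ClassicalLinkage.isAlgebraicSet_configSpace {V : Type*} {L : ClassicalLinkage 2 V}
    (hL : L.fixed = ∅) : IsAlgebraicSet L.configSpace := by
  have hc : ∀ (v w : V) (i : Fin 2), IsPolynomial fun φ : V → R 2 => (φ v - φ w) i := fun v w i =>
    IsPolynomial.coord ((isPolynomialMap_eval v).sub (isPolynomialMap_eval w)) i
  have := isAlgebraicSet_forall (α := {q : V × V // L.graph.Adj q.1 q.2})
    (p := fun q (φ : V → R 2) => ((φ q.1.1 - φ q.1.2) 0 ^ 2 + (φ q.1.1 - φ q.1.2) 1 ^ 2) -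
      L.len ⟨s(q.1.1, q.1.2), q.2⟩ ^ 2)
    (fun q => (((hc _ _ 0).pow 2).add ((hc _ _ 1).pow 2)).sub (IsPolynomial.const _))
  convert this using 1
  ext φ
  rw [mem_configSpace hL]
  have key : ∀ (v w : V) (h : L.graph.Adj v w), ‖φ v - φ w‖ = L.len ⟨s(v, w), h⟩ ↔
      ((φ v - φ w) 0 ^ 2 + (φ v - φ w) 1 ^ 2) - L.len ⟨s(v, w), h⟩ ^ 2 = 0 := by
    intro v w h
    rw [← sq_eq_sq₀ (norm_nonneg _) (L.len_pos _).le, EuclideanSpace.real_norm_sq_eq,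
      Fin.sum_univ_two, sub_eq_zero]
  exact ⟨fun h q => (key _ _ q.2).1 (h _ _ q.2), fun h v w hvw => (key v w hvw).2 (h ⟨(v, w), hvw⟩)⟩

/-- The bound is the total length of the walk, hence uniform in `φ`. It makes the slice with one
vertex held at the origin bounded. -/
theorem ClassicalLinkage.exists_dist_le {n : ℕ} {V : Type*} {L : ClassicalLinkage n V}
    {v w : V} (p : L.graph.Walk v w) : ∃ K : ℝ, ∀ φ ∈ L.configSpace, ‖φ w - φ v‖ ≤ K := by
  induction p with
  | nil => exact ⟨0, fun φ _ => by simp⟩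
  | @cons u v w h p ih =>
    obtain ⟨K, hK⟩ := ih
    refine ⟨K + L.len ⟨s(u, v), h⟩, fun φ hφ => ?_⟩
    rw [← hφ.2 u v h, norm_sub_rev (φ u)]
    calc ‖φ w - φ u‖ = ‖(φ w - φ v) + (φ v - φ u)‖ := by rw [sub_add_sub_cancel]
      _ ≤ _ := (norm_add_le _ _).trans (add_le_add_left (hK φ hφ) _)

theorem exists_slice {V : Type*} [Fintype V] [Nontrivial V] (L : ClassicalLinkage 2 V)
    (hconn : L.graph.Connected) (hL : L.fixed = ∅) :
    ∃ Z' : Set (V → R 2), Z' ⊆ L.configSpace ∧ IsAlgebraicSet Z' ∧ IsCompact Z' ∧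
      IsIsomorphism (Z' ×ˢ EucPlus 2) L.configSpace (fun p => act p.2 p.1) := by
  obtain ⟨v⟩ : Nonempty V := inferInstance
  obtain ⟨w, hvw⟩ := hconn.preconnected.exists_adj_of_nontrivial v
  set l := L.len ⟨s(v, w), hvw⟩ with hl
  have hl0 : 0 < l := L.len_pos _
  have hlc : (l : ℂ) ≠ 0 := by exact_mod_cast hl0.ne'
  have hcoord : ∀ (u : V) (i : Fin 2), IsPolynomial fun φ : V → R 2 => φ u i := fun u i =>
    IsPolynomial.coord (isPolynomialMap_eval u) i
  -- With the chosen edge running from `0` to `l`, the slice meets every orbit of orientation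
  -- preserving motions exactly once.
  let Z' : Set (V → R 2) := L.configSpace ∩ ({φ | ∀ i, φ v i = 0} ∩
    {φ | ∀ i, φ w i - toPlane l i = 0})
  have hv : ∀ φ ∈ Z', toPlane.symm (φ v) = 0 := fun φ hφ => by
    rw [show φ v = 0 from PiLp.ext hφ.2.1, map_zero]
  have hw : ∀ φ ∈ Z', toPlane.symm (φ w) = l := fun φ hφ => by
    rw [show φ w = toPlane l from PiLp.ext fun i => sub_eq_zero.1 (hφ.2.2 i),
      LinearIsometryEquiv.symm_apply_apply]
  have hZ'alg : IsAlgebraicSet Z' := (ClassicalLinkage.isAlgebraicSet_configSpace hL).inter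
    ((isAlgebraicSet_forall fun i => hcoord v i).inter
      (isAlgebraicSet_forall fun i => (hcoord w i).sub (IsPolynomial.const _)))
  have hZ'comp : IsCompact Z' := by
    have hK : ∀ u, ∃ K : ℝ, ∀ φ ∈ L.configSpace, ‖φ u - φ v‖ ≤ K := fun u => by
      obtain ⟨p⟩ := hconn.preconnected v u
      exact ClassicalLinkage.exists_dist_le p
    choose K hK using hK
    refine (isCompact_univ_pi fun u => isCompact_closedBall (0 : R 2) (K u)).of_isClosed_subset
      hZ'alg.isClosed fun φ hφ u _ => ?_
    have := hK u φ hφ.1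
    rwa [show φ v = 0 from PiLp.ext hφ.2.1, sub_zero, ← mem_closedBall_zero_iff] at this
  -- This is the unit direction of the edge. Its inverse is its conjugate and the only division is
  -- by the constant `l`, so `g` is polynomial.
  let a : (V → R 2) → ℂ := fun φ => ((l⁻¹ : ℝ) : ℂ) * (toPlane.symm (φ w) - toPlane.symm (φ v))
  let g : (V → R 2) → (V → R 2) × AffineData 2 := fun φ =>
    (fun u => toPlane ((starRingEnd ℂ) (a φ) * (toPlane.symm (φ u) - toPlane.symm (φ v))),
      (mulMatrix (a φ), φ v))
  have ha : ∀ φ ∈ L.configSpace, ‖a φ‖ = 1 := by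
    intro φ hφ
    rw [norm_mul, ← map_sub, LinearIsometryEquiv.norm_map, norm_sub_rev, hφ.2 v w hvw, norm_real,
      Real.norm_of_nonneg (inv_nonneg.2 hl0.le), inv_mul_cancel₀ hl0.ne']
  have haa : ∀ φ ∈ L.configSpace, a φ * (starRingEnd ℂ) (a φ) = 1 := by
    intro φ hφ
    rw [mul_conj', ha φ hφ]; norm_num
  have hpu : ∀ u, IsPolynomialMap fun φ : V → R 2 => toPlane.symm (φ u) := fun u =>
    (isPolynomialMap_eval u).linear_comp
      toPlane.symm.toLinearEquiv.toLinearMap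
  have hpa : IsPolynomialMap a :=
    (IsPolynomialMap.const _).complex_mul ((hpu w).sub (hpu v))
  have hg : IsPolynomialMap g := by
    refine (IsPolynomialMap.pi fun u => ?_).prodMk
      (hpa.mulMatrix.prodMk (isPolynomialMap_eval v))
    exact ((hpa.linear_comp conjAe.toLinearMap).complex_mul
      ((hpu u).sub (hpu v))).linear_comp toPlane.toLinearEquiv.toLinearMap
  have hdecomp : ∀ q ∈ EucPlus 2, ∃ α β : ℂ, ‖α‖ = 1 ∧ q = (mulMatrix α, toPlane β) := by
    rintro ⟨Q, t⟩ hQ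
    obtain ⟨h1, h2⟩ := exists_mulMatrix hQ
    exact ⟨_, toPlane.symm t, h1, Prod.ext h2 (LinearIsometryEquiv.apply_symm_apply _ _).symm⟩
  have hinv : Set.InvOn g (fun p => act p.2 p.1) (Z' ×ˢ EucPlus 2) L.configSpace := by
    constructor
    · rintro ⟨z, q⟩ ⟨hz, hq⟩
      obtain ⟨α, β, hα, rfl⟩ := hdecomp q hq
      have e : ∀ u, toPlane.symm (act (mulMatrix α, toPlane β) z u) =
          α * toPlane.symm (z u) + β := fun u => by
        rw [act_mulMatrix, LinearIsometryEquiv.symm_apply_apply]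
      have ea : a (act (mulMatrix α, toPlane β) z) = α := by
        simp only [a, e, hv z hz, hw z hz]
        push_cast
        field_simp
        ring
      have hα' : (starRingEnd ℂ) α * α = 1 := by rw [conj_mul', hα]; norm_num
      refine Prod.ext (funext fun u => ?_) (Prod.ext ?_ ?_)
      · simp only [g, ea, e, hv z hz]
        rw [mul_zero, zero_add, add_sub_cancel_right, ← mul_assoc, hα', one_mul,
          LinearIsometryEquiv.apply_symm_apply]
      · simp only [g, ea]
      · simp only [g]
        rw [act_mulMatrix, hv z hz, mul_zero, zero_add]
    · intro φ hφ
      funext u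
      have : g φ = ((g φ).1, (mulMatrix (a φ), toPlane (toPlane.symm (φ v)))) := by
        simp only [g, LinearIsometryEquiv.apply_symm_apply]
      rw [this]
      simp only [act_mulMatrix]
      simp only [g, LinearIsometryEquiv.symm_apply_apply]
      rw [← mul_assoc, haa φ hφ, one_mul, sub_add_cancel, LinearIsometryEquiv.apply_symm_apply]
  refine ⟨Z', Set.inter_subset_left, hZ'alg, hZ'comp, hinv.bijOn ?_ ?_,
    ⟨_, isPolynomialMap_act.isEntireRationalMap, fun _ _ => rfl⟩, g, hg.isEntireRationalMap, hinv⟩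
  · rintro ⟨z, q⟩ ⟨hz, hq⟩
    obtain ⟨α, β, hα, rfl⟩ := hdecomp q hq
    rw [ClassicalLinkage.mem_configSpace hL]
    intro u u' h
    simp only [act_mulMatrix]
    rw [← map_sub, LinearIsometryEquiv.norm_map, add_sub_add_right_eq_sub, ← mul_sub, norm_mul, hα,
      one_mul, ← map_sub, LinearIsometryEquiv.norm_map]
    exact hz.1.2 u u' h
  · intro φ hφ
    refine ⟨⟨?_, fun i => ?_, fun i => ?_⟩, mulMatrix_mem (ha φ hφ)⟩
    · rw [ClassicalLinkage.mem_configSpace hL]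
      intro u u' h
      simp only [g]
      rw [← map_sub, LinearIsometryEquiv.norm_map, ← mul_sub, sub_sub_sub_cancel_right, norm_mul,
        norm_conj, ha φ hφ, one_mul, ← map_sub, LinearIsometryEquiv.norm_map]
      exact hφ.2 u u' h
    · simp [g]
    · have : (starRingEnd ℂ) (a φ) * (toPlane.symm (φ w) - toPlane.symm (φ v)) = l := by
        have h1 := haa φ hφ
        have h2 : toPlane.symm (φ w) - toPlane.symm (φ v) = l * a φ := by
          simp only [a]; push_cast; field_simp
        rw [h2]
        linear_combination (l : ℂ) * h1
      simp only [g, this, sub_self]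

/-! ### Realizing split algebraic sets by linkages -/

section Realize

variable {k : ℕ}

/-- The linkage underlying a stage, without fixed vertices. -/
def Stage.toLinkage {ι A : Type} [Fintype ι] {T : Set ι} {W Z : Set (ι → ℂ)} (S : Stage ι T W Z)
    (e : A ≃ S.V) : ClassicalLinkage 2 A where
  graph :=
    { Adj := fun v w => S.len (e v) (e w) ≠ 0
      symm := ⟨fun v w h => by rwa [S.len_symm]⟩
      loopless := ⟨fun v h => h (S.len_self _)⟩ }
  len q := Sym2.lift ⟨fun v w => S.len (e v) (e w), fun _ _ => S.len_symm _ _⟩ q.1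
  len_pos := by
    rintro ⟨q, hq⟩
    induction q using Sym2.ind with
    | _ v w => exact lt_of_le_of_ne (S.len_nonneg _ _) (Ne.symm hq)
  fixed := ∅
  pos v := absurd v.2 (Set.notMem_empty _)

theorem Stage.mem_toLinkage {ι A : Type} [Fintype ι] {T : Set ι} {W Z : Set (ι → ℂ)}
    (S : Stage ι T W Z) (e : A ≃ S.V) (φ : A → R 2) : φ ∈ (S.toLinkage e).configSpace ↔
      ∀ v w, S.len v w ≠ 0 →
        ‖toPlane.symm (φ (e.symm v)) - toPlane.symm (φ (e.symm w))‖ = S.len v w := by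
  rw [ClassicalLinkage.mem_configSpace rfl]
  constructor
  · intro h v w hvw
    rw [← map_sub, LinearIsometryEquiv.norm_map]
    have := h (e.symm v) (e.symm w) (by simpa [toLinkage] using hvw)
    simpa [toLinkage] using this
  · intro h v w hvw
    have := h (e v) (e w) hvw
    rw [e.symm_apply_apply, e.symm_apply_apply, ← map_sub, LinearIsometryEquiv.norm_map] at this
    exact this

theorem Stage.toLinkage_connected {ι A : Type} [Fintype ι] {W Z : Set (ι → ℂ)}
    (S : Stage ι ∅ W Z) (e : A ≃ S.V) : (S.toLinkage e).graph.Connected := by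
  have key : ∀ v, (S.toLinkage e).graph.Reachable (e.symm (S.fr 0)) (e.symm v) := by
    refine S.conn _ (fun v w h hv => hv.trans ?_) (SimpleGraph.Reachable.refl _)
      fun i hi => absurd hi (Set.notMem_empty _)
    exact SimpleGraph.Adj.reachable (by simpa [toLinkage] using h)
  have key' : ∀ v, (S.toLinkage e).graph.Reachable (e.symm (S.fr 0)) v := fun v => by
    simpa using key (e v)
  have : Nonempty A := ⟨e.symm (S.fr 0)⟩
  exact ⟨fun v w => (key' v).symm.trans (key' w)⟩

/-- The coordinatewise identification of complex and plane configurations. -/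
def toPlanes (A : Type) [Fintype A] : (A → ℂ) →L[ℝ] (A → R 2) :=
  ContinuousLinearMap.pi fun i =>
    (toPlane.toContinuousLinearEquiv : ℂ →L[ℝ] R 2).comp (ContinuousLinearMap.proj i)

/-- The inverse of `toPlanes`. -/
def ofPlanes (A : Type) [Fintype A] : (A → R 2) →L[ℝ] (A → ℂ) :=
  ContinuousLinearMap.pi fun i =>
    (toPlane.symm.toContinuousLinearEquiv : R 2 →L[ℝ] ℂ).comp (ContinuousLinearMap.proj i)

theorem toPlanes_apply {A : Type} [Fintype A] (y : A → ℂ) (i : A) :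
    toPlanes A y i = toPlane (y i) := rfl

theorem ofPlanes_apply {A : Type} [Fintype A] (x : A → R 2) (i : A) :
    ofPlanes A x i = toPlane.symm (x i) := rfl

theorem toPlanes_ofPlanes {A : Type} [Fintype A] (x : A → R 2) :
    toPlanes A (ofPlanes A x) = x :=
  funext fun _ => toPlane.apply_symm_apply _

theorem reflection_mem : (!![1, 0; 0, -1], 0) ∈ Euc 2 := by
  change _ ∈ Matrix.orthogonalGroup (Fin 2) ℝ
  rw [Matrix.mem_orthogonalGroup_iff]
  ext i j
  fin_cases i <;> fin_cases j <;> simp [Matrix.mul_apply, Fin.sum_univ_two]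

theorem act_reflection {A : Type} [Fintype A] (y : A → ℂ) :
    act (!![1, 0; 0, -1], 0) (toPlanes A y) = toPlanes A fun i => (starRingEnd ℂ) (y i) := by
  funext v
  ext i
  fin_cases i
  · simp [act, toPlanes_apply, toPlane_apply_zero, dotProduct, Fin.sum_univ_two]
  · simp [act, toPlanes_apply, toPlane_apply_one, dotProduct, Fin.sum_univ_two]

/-- An equivariant product decomposition yields a splitting, whose slice may be translated. -/
theorem exists_splitting {Z Z' : Set (Fin k → R 2)} (hZ : IsEucInvariant Z)
    (hiso : IsIsomorphism (Z' ×ˢ EucPlus 2) Z (fun p => act p.2 p.1)) (t : ℂ) :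
    Nonempty (Splitting {y | toPlanes (Fin k) y ∈ Z}
      {y | toPlanes (Fin k) (fun i => y i - t) ∈ Z'}) := by
  obtain ⟨hbij, -, g, hg, hl, hr⟩ := hiso
  have hmem : ∀ x ∈ Z, g x ∈ Z' ×ˢ EucPlus 2 := by
    intro x hx
    obtain ⟨p, hp, rfl⟩ := hbij.surjOn hx
    rw [hl hp]
    exact hp
  have han : ∀ (l : Module.Dual ℝ ((Fin k → R 2) × AffineData 2)) (y : Fin k → ℂ),
      AnalyticAt ℝ (fun y => ((l (g (toPlanes (Fin k) y)) : ℝ) : ℂ)) y := fun l y =>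
    analyticAt_ofReal (AnalyticAt.comp (g := fun x => l (g x)) (f := toPlanes (Fin k))
      ((hg l).analyticAt _) ((toPlanes (Fin k)).analyticAt y))
  have hanR : ∀ (l : ((Fin k → R 2) × AffineData 2) →ₗ[ℝ] R 2) (y : Fin k → ℂ),
      AnalyticAt ℝ (fun y => toPlane.symm (l (g (toPlanes (Fin k) y)))) y := by
    intro l y
    simp only [toPlane_symm_apply]
    have hc : ∀ i : Fin 2, AnalyticAt ℝ
        (fun y => ((l (g (toPlanes (Fin k) y)) i : ℝ) : ℂ)) y := fun i =>
      han (((LinearMap.proj i).comp (WithLp.linearEquiv 2 ℝ (Fin 2 → ℝ)).toLinearMap).comp l) y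
    exact (hc 0).add ((hc 1).mul analyticAt_const)
  let rot : (Fin k → ℂ) → ℂ := fun y =>
    ⟨(g (toPlanes (Fin k) y)).2.1 0 0, (g (toPlanes (Fin k) y)).2.1 1 0⟩
  have hrot : ∀ y, AnalyticAt ℝ rot y := by
    intro y
    have e : rot = fun y => (((g (toPlanes (Fin k) y)).2.1 0 0 : ℝ) : ℂ) +
        (((g (toPlanes (Fin k) y)).2.1 1 0 : ℝ) : ℂ) * I := funext fun y => mk_eq_add_mul_I _ _
    have hc : ∀ i j : Fin 2, AnalyticAt ℝ
        (fun y => (((g (toPlanes (Fin k) y)).2.1 i j : ℝ) : ℂ)) y := fun i j =>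
      han (((LinearMap.proj (R := ℝ) (φ := fun _ : Fin 2 => ℝ) j).comp
        (LinearMap.proj (R := ℝ) (φ := fun _ : Fin 2 => Fin 2 → ℝ) i)).comp
        ((LinearMap.fst ℝ (Fin 2 → Fin 2 → ℝ) (R 2)).comp
          (LinearMap.snd ℝ (Fin k → R 2) ((Fin 2 → Fin 2 → ℝ) × R 2)))) y
    rw [e]
    exact (hc 0 0).add ((hc 1 0).mul analyticAt_const)
  have hq : ∀ y, toPlanes (Fin k) y ∈ Z → ‖rot y‖ = 1 ∧ (g (toPlanes (Fin k) y)).2 =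
      (mulMatrix (rot y), toPlane (toPlane.symm (g (toPlanes (Fin k) y)).2.2)) := by
    intro y hy
    obtain ⟨h1, h2⟩ := exists_mulMatrix (hmem _ hy).2
    exact ⟨h1, Prod.ext h2 (toPlane.apply_symm_apply _).symm⟩
  exact ⟨{
    rot := rot
    -- The slice is shifted by `t` before it is rotated, so the translation must compensate for `rot
    -- y * t`.
    trans := fun y => toPlane.symm (g (toPlanes (Fin k) y)).2.2 - rot y * t
    slice := fun y i => toPlane.symm ((g (toPlanes (Fin k) y)).1 i) + t
    norm_rot := fun y hy => (hq y hy).1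
    slice_mem := fun y hy => by
      have := (hmem _ hy).1
      rw [Set.mem_ofPred_eq]
      convert this using 1
      funext i
      rw [toPlanes_apply, add_sub_cancel_right, toPlane.apply_symm_apply]
    eq := fun y hy i => by
      have h1 : act (g (toPlanes (Fin k) y)).2 (g (toPlanes (Fin k) y)).1 i = _ :=
        congrFun (hr hy) i
      rw [(hq y hy).2, act_mulMatrix, toPlanes_apply] at h1
      have h2 := toPlane.injective h1
      rw [← h2]
      ring
    unique := fun z hz a b ha x hx => by
      have hp : ((toPlanes (Fin k) fun i => z i - t), (mulMatrix a, toPlane (b + a * t))) ∈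
          Z' ×ˢ EucPlus 2 := ⟨hz, mulMatrix_mem ha⟩
      have hf : act (mulMatrix a, toPlane (b + a * t)) (toPlanes (Fin k) fun i => z i - t) =
          toPlanes (Fin k) x := funext fun i => by
        rw [act_mulMatrix, toPlanes_apply, toPlanes_apply, toPlane.symm_apply_apply, hx]
        congr 1
        ring
      have h1 : toPlanes (Fin k) x ∈ Z := hf ▸ hbij.mapsTo hp
      have h2 := hl hp
      dsimp only at h2
      rw [hf] at h2
      have h3 : rot x = a := by
        simp only [rot, h2]
        rfl
      refine ⟨h1, h3, ?_, funext fun i => ?_⟩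
      · simp only [h3]
        rw [h2, toPlane.symm_apply_apply, add_sub_cancel_right]
      · rw [h2]
        change toPlane.symm (toPlanes (Fin k) (fun i => z i - t) i) + t = z i
        rw [toPlanes_apply, toPlane.symm_apply_apply, sub_add_cancel]
    conj_mem := fun y hy => by
      have := hZ _ reflection_mem _ hy
      rwa [act_reflection] at this
    analytic_rot := fun y _ => hrot y
    analytic_trans := fun y _ => (hanR ((LinearMap.snd ℝ _ (R 2)).comp
      (LinearMap.snd ℝ (Fin k → R 2) (AffineData 2))) y).sub ((hrot y).mul analyticAt_const)
    analytic_slice := fun y _ => AnalyticAt.pi fun i =>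
      (hanR ((LinearMap.proj i).comp (LinearMap.fst ℝ (Fin k → R 2) (AffineData 2))) y).add
        analyticAt_const }⟩

theorem exists_linkage (Z : Set (Fin k → R 2)) (hZ : IsEucInvariant Z) (Z' : Set (Fin k → R 2))
    (hZ' : IsAlgebraicSet Z') (hcomp : IsCompact Z')
    (hiso : IsIsomorphism (Z' ×ˢ EucPlus 2) Z (fun p => act p.2 p.1)) :
    ∃ (m : ℕ) (L : ClassicalLinkage 2 (Fin k ⊕ Fin m)) (F : Set ℝ),
      L.graph.Connected ∧ L.fixed = ∅ ∧ F.Finite ∧ F.Nonempty ∧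
      ∃ α : (Fin k → R 2) × ℝ → (Fin m → R 2),
        IsAnalyticOnSubset (Z ×ˢ F) α ∧
        L.configSpace = {φ | ∃ x ∈ Z, ∃ f ∈ F, φ = Sum.elim x (α (x, f))} ∧
        IsAnalyticIsomorphism (Z ×ˢ F) L.configSpace (fun p => Sum.elim p.1 (α p)) := by
  obtain ⟨M, hM, hbound⟩ := hcomp.exists_lt (g := fun x => ‖x‖) continuous_norm.continuousOn
  -- All points of configurations in `Z'` have norm below `M`. Shifting the slice by `M` puts them
  -- in `0 < |y i| < 2 * M`, as the anchoring elbows require.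
  obtain ⟨D⟩ := exists_splitting hZ hiso (M : ℂ)
  obtain ⟨p, hp, hp0, hpZ⟩ := hZ'.exists_nonneg
  have hset : {y | toPlanes (Fin k) (fun i => y i - (M : ℂ)) ∈ Z'} =
      {y : Fin k → ℂ | p (toPlanes (Fin k) fun i => y i - (M : ℂ)) = 0} := by
    rw [hpZ]; rfl
  have hpc : IsPolynomial fun y : Fin k → ℂ => p (toPlanes (Fin k) fun i => y i - (M : ℂ)) := by
    refine IsPolynomialMap.comp_isPolynomial ?_ hp
    exact ((IsPolynomialMap.linear LinearMap.id).sub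
      (IsPolynomialMap.const fun _ => (M : ℂ))).linear_comp (toPlanes (Fin k)).toLinearMap
  obtain ⟨S⟩ := Stage.exists_of_isPolynomial (R := 2 * M) hpc (fun y => hp0 _) (by positivity) (by
    intro y hy i
    have h1 : toPlanes (Fin k) (fun i => y i - (M : ℂ)) ∈ Z' := by rw [hpZ]; exact hy
    have h2 := (norm_le_pi_norm _ i).trans_lt (hbound _ h1)
    rw [toPlanes_apply, LinearIsometryEquiv.norm_map] at h2
    have h3 : ‖(M : ℂ)‖ = M := by rw [norm_real, Real.norm_of_nonneg hM.le]
    constructor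
    · refine norm_pos_iff.2 fun e => ?_
      rw [e, zero_sub, norm_neg, h3] at h2
      exact lt_irrefl _ h2
    · have h4 := norm_add_le (y i - (M : ℂ)) (M : ℂ)
      rw [sub_add_cancel, h3] at h4
      linarith)
  rw [← hset] at S
  classical
  obtain ⟨m, ⟨e₀⟩⟩ := Finite.exists_equiv_fin ↥((Set.range S.inp)ᶜ)
  -- The inputs are enumerated first, so the configuration space becomes a union of graphs over the
  -- first `k` points.
  let e : Fin k ⊕ Fin m ≃ S.V := (Equiv.sumCongr (Equiv.ofInjective S.inp S.inp_inj) e₀.symm).trans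
    (Equiv.Set.sumCompl (Set.range S.inp))
  have he : ∀ i, e (Sum.inl i) = S.inp i := fun i => by simp [e]
  have he' : ∀ i, e.symm (S.inp i) = Sum.inl i := fun i => by rw [← he, e.symm_apply_apply]
  let b : S.F × Bool → (Fin k → R 2) → Fin m → R 2 := fun j x u =>
    toPlane (S.unframedBranch D j (ofPlanes (Fin k) x) (e (Sum.inr u)))
  have hmemZ : ∀ x ∈ Z, ofPlanes (Fin k) x ∈ {y | toPlanes (Fin k) y ∈ Z} := fun x hx => by
    rw [Set.mem_ofPred_eq, toPlanes_ofPlanes]; exact hx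
  have hbranch : ∀ x ∈ Z, ∀ j v, Sum.elim x (b j x) (e.symm v) =
      toPlane (S.unframedBranch D j (ofPlanes (Fin k) x) v) := by
    intro x hx j v
    obtain ⟨u, rfl⟩ := e.surjective v
    rw [e.symm_apply_apply]
    rcases u with i | u
    · rw [he, S.unframedBranch_inp j (hmemZ x hx), ofPlanes_apply, toPlane.apply_symm_apply]
      rfl
    · rfl
  obtain ⟨F, hF, hF', α, h1, h2, h3⟩ := exists_analyticIsomorphism_of_sections Z
    (S.toLinkage e).configSpace b
    (by
      intro j x hx
      refine AnalyticAt.pi fun u => ?_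
      refine ((toPlane.toContinuousLinearEquiv : ℂ →L[ℝ] R 2).analyticAt _).comp ?_
      exact AnalyticAt.comp (g := fun y => S.unframedBranch D j y (e (Sum.inr u)))
        (S.analytic_unframedBranch j _ _ (hmemZ x hx)) ((ofPlanes (Fin k)).analyticAt x))
    (by
      intro x hx j j' h
      refine S.unframedBranch_injective (D := D) (hmemZ x hx) (funext fun v => toPlane.injective ?_)
      rw [← hbranch x hx, ← hbranch x hx, h])
    (by
      ext φ
      rw [S.mem_toLinkage, S.unframed_spec D fun v => toPlane.symm (φ (e.symm v))]
      have hin : (fun v => toPlane.symm (φ (e.symm v))) ∘ S.inp =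
          ofPlanes (Fin k) fun i => φ (Sum.inl i) := funext fun i => by
        rw [Function.comp_apply, he', ofPlanes_apply]
      rw [hin, Set.mem_ofPred_eq, toPlanes_ofPlanes]
      constructor
      · rintro ⟨hx, j, hj⟩
        refine ⟨_, hx, j, funext fun v => ?_⟩
        have := hbranch _ hx j (e v)
        rw [e.symm_apply_apply] at this
        rw [this, ← congrFun hj, e.symm_apply_apply, toPlane.apply_symm_apply]
      · rintro ⟨x, hx, j, rfl⟩
        refine ⟨hx, j, funext fun v => ?_⟩
        rw [hbranch x hx, toPlane.symm_apply_apply]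
        rfl)
  exact ⟨m, S.toLinkage e, F, S.toLinkage_connected e, rfl, hF, hF', α, h1, h2, h3⟩

end Realize

end LinkageSpaces

end

open LinkageSpaces in
theorem mainTheorem8 :
    (∀ (k : ℕ) (Z : Set (Fin k → R 2)), IsAlgebraicSet Z → IsEucInvariant Z →
      ∀ Z' : Set (Fin k → R 2), Z' ⊆ Z → IsAlgebraicSet Z' → IsCompact Z' →
        IsIsomorphism (Z' ×ˢ EucPlus 2) Z (fun p => act p.2 p.1) →
        ∃ (m : ℕ) (L : ClassicalLinkage 2 (Fin k ⊕ Fin m)) (F : Set ℝ),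
          L.graph.Connected ∧ L.fixed = ∅ ∧ F.Finite ∧ F.Nonempty ∧
          AnalyticallyIsomorphic (Z ×ˢ F) L.configSpace ∧
          ∃ α : (Fin k → R 2) × ℝ → (Fin m → R 2),
            IsAnalyticOnSubset (Z ×ˢ F) α ∧
            L.configSpace = {φ | ∃ x ∈ Z, ∃ f ∈ F, φ = Sum.elim x (α (x, f))} ∧
            IsAnalyticIsomorphism (Z ×ˢ F) L.configSpace
              (fun p => Sum.elim p.1 (α p))) ∧
    (∀ (V : Type*) [Fintype V] [Nontrivial V] (L : ClassicalLinkage 2 V),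
      L.graph.Connected → L.fixed = ∅ →
        ∃ Z' : Set (V → R 2), Z' ⊆ L.configSpace ∧ IsAlgebraicSet Z' ∧ IsCompact Z' ∧
          IsIsomorphism (Z' ×ˢ EucPlus 2) L.configSpace (fun p => act p.2 p.1)) := by
  refine ⟨fun k Z _ hZ Z' _ hZ' hcomp hiso => ?_, fun V _ _ L hconn hL => exists_slice L hconn hL⟩
  obtain ⟨m, L, F, h1, h2, h3, h4, α, h5, h6, h7⟩ := exists_linkage Z hZ Z' hZ' hcomp hiso
  exact ⟨m, L, F, h1, h2, h3, h4, ⟨_, h7⟩, α, h5, h6, h7⟩
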